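/- Let $G$ be a discrete group. All compact $G$-spaces are compact Hausdorff spaces on which $G$ acts by homeomorphisms; for such $X$, $G$ acts on $C(X)$ by $(sf)(x)=f(s^{-1}x)$, and $G$ acts on $\ell^\infty(G)$ by $(sf)(t)=f(s^{-1}t)$. A $G$-operator system is a unital self-adjoint subspace of a unital C*-algebra with an action of $G$ by unital complete order automorphisms. A $G$-operator system $\mathcal U$ is $G$-injective if unital completely positive $G$-equivariant maps $\mathcal S\to\mathcal U$ extend along unital completely isometric $G$-equivariant maps $\mathcal S\to\mathcal T$. A $G$-injective envelope of $\mathbb C$ (with trivial action) is a $G$-injective $\mathcal U$ with a unital completely isometric $G$-equivariant map $\iota:\mathbb C\to\mathcal U$ that is $G$-essential: every unital completely positive $G$-equivariant map $\phi:\mathcal U\to\mathcal T$ with $\phi\iota$ completely isometric is itself completely isometric. A Hamana boundary of $G$ is a compact $G$-space $X$ such that $C(X)$ is a $G$-injective envelope of $\mathbb C$. A $G$-boundary is a nonempty compact $G$-space that is minimal (every orbit is dense) and strongly proximal (the weak* closure of the $G$-orbit of every regular Borel probability measure contains a point mass). A Furstenberg boundary is a $G$-boundary of which every $G$-boundary is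 a continuous $G$-equivariant image. The group $G$ is amenable if $\ell^\infty(G)$ has a unital positive linear functional invariant under left translation. A unital positive $G$-equivariant projection $\psi$ on $\ell^\infty(G)$ is called minimal if its image is minimal under inclusion among the images of such projections; its image is given the Choi–Effros product $a\cdot b=\psi(ab)$. Then the following hold. 1. A Hamana boundary $\partial_H G$ of $G$ exists and is unique up to $G$-equivariant homeomorphism, and every $G$-injective envelope of $\mathbb C$ is isomorphic to $C(\partial_H G)$ by a unital completely isometric $G$-equivariant linear bijection. 2. Minimal unital positive $G$-equivariant projections on $\ell^\infty(G)$ exist. For each of them the image, with the Choi–Effros product, is $G$-equivariantly and isometrically *-isomorphic to $C(\partial_H G)$; for at least one of them the image is a C*-subalgebra of $\ell^\infty(G)$, that is, the isomorphism is a *-homomorphism from $C(\partial_H G)$ into $\ell^\infty(G)$. Conversely, if $X$ is a compact $G$-space and $C(X)$ is $G$-equivariantly and isometrically *-isomorphic to the image of a minimal projection with the Choi–Effros product, then $X$ is a Hamana boundary. 3. $\partial_H G$ is nonempty, minimal and strongly proximal, so it is a $G$-boundary. 4. For every $G$-boundary $B$ there is a continuous $G$-equivariant map from $\partial_H G$ onto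 $B$. Hence $\partial_H G$ is the Furstenberg boundary $\partial_F G$: a compact $G$-space is a Hamana boundary if and only if it is a Furstenberg boundary. 5. $\partial_H G$ is a single point if and only if $G$ is amenable. -/

import Mathlib

open scoped ComplexOrder ENNReal

universe u v w

noncomputable section

/-! ### Operator systems with a group action -/

/-- A `G`-operator system: a unital self-adjoint subspace `carrier` of a unital C*-algebra
`Ambient`, with an action of `G` by unital complete order automorphisms (each `act s` is unital and
completely positive, and so is its inverse `act s⁻¹`). The order on `Ambient` is determined by
`StarOrderedRing`: it is the usual order of the C*-algebra. -/
structure GOperatorSystem (G : Type u) [Group G] where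
  Ambient : Type v
  [cstar : CStarAlgebra Ambient]
  [order : PartialOrder Ambient]
  [starOrdered : StarOrderedRing Ambient]
  carrier : Submodule ℂ Ambient
  one_mem : (1 : Ambient) ∈ carrier
  star_mem : ∀ a ∈ carrier, star a ∈ carrier
  act : G →* Module.End ℂ carrier
  act_one : ∀ s, act s ⟨1, one_mem⟩ = ⟨1, one_mem⟩
  act_completelyPositive : ∀ (s : G) (n : ℕ) (M : CStarMatrix (Fin n) (Fin n) carrier),
    0 ≤ M.map (fun x => (x : Ambient)) → 0 ≤ M.map (fun x => (act s x : Ambient))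

attribute [instance] GOperatorSystem.cstar GOperatorSystem.order GOperatorSystem.starOrdered

namespace GOperatorSystem

variable {G : Type u} [Group G]

/-- The unit of an operator system. -/
def unit (S : GOperatorSystem.{u, v} G) : S.carrier := ⟨1, S.one_mem⟩

/-- `φ` is a unital map of operator systems. -/
def IsUnital {S : GOperatorSystem.{u, v} G} {T : GOperatorSystem.{u, w} G}
    (φ : S.carrier →ₗ[ℂ] T.carrier) : Prop :=
  φ S.unit = T.unit

/-- `φ` commutes with the `G`-actions. -/
def IsEquivariant {S : GOperatorSystem.{u, v} G} {T : GOperatorSystem.{u, w} G}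
    (φ : S.carrier →ₗ[ℂ] T.carrier) : Prop :=
  ∀ (s : G) (x : S.carrier), φ (S.act s x) = T.act s (φ x)

/-- All matrix amplifications of `φ` are positive. -/
def IsCompletelyPositive {S : GOperatorSystem.{u, v} G} {T : GOperatorSystem.{u, w} G}
    (φ : S.carrier →ₗ[ℂ] T.carrier) : Prop :=
  ∀ (n : ℕ) (M : CStarMatrix (Fin n) (Fin n) S.carrier),
    0 ≤ M.map (fun x => (x : S.Ambient)) → 0 ≤ M.map (fun x => (φ x : T.Ambient))

/-- All matrix amplifications of `φ` are isometric. -/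
def IsCompletelyIsometric {S : GOperatorSystem.{u, v} G} {T : GOperatorSystem.{u, w} G}
    (φ : S.carrier →ₗ[ℂ] T.carrier) : Prop :=
  ∀ (n : ℕ) (M : CStarMatrix (Fin n) (Fin n) S.carrier),
    ‖M.map (fun x => (φ x : T.Ambient))‖ = ‖M.map (fun x => (x : S.Ambient))‖

/-- Unital completely positive `G`-equivariant maps. -/
structure IsGUCP {S : GOperatorSystem.{u, v} G} {T : GOperatorSystem.{u, w} G}
    (φ : S.carrier →ₗ[ℂ] T.carrier) : Prop where
  unital : IsUnital φ
  completelyPositive : IsCompletelyPositive φ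
  equivariant : IsEquivariant φ

/-- Unital completely isometric `G`-equivariant maps; `(T, φ)` is then a `G`-extension of `S`. -/
structure IsGExtension {S : GOperatorSystem.{u, v} G} {T : GOperatorSystem.{u, w} G}
    (φ : S.carrier →ₗ[ℂ] T.carrier) : Prop where
  unital : IsUnital φ
  completelyIsometric : IsCompletelyIsometric φ
  equivariant : IsEquivariant φ

/-- `G`-injectivity: unital completely positive `G`-equivariant maps into `U` extend along
unital completely isometric `G`-equivariant maps. -/
def IsGInjective (U : GOperatorSystem.{u, v} G) : Prop :=
  ∀ (S T : GOperatorSystem.{u, v} G) (ι : S.carrier →ₗ[ℂ] T.carrier)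
    (φ : S.carrier →ₗ[ℂ] U.carrier), IsGExtension ι → IsGUCP φ →
    ∃ φ' : T.carrier →ₗ[ℂ] U.carrier, IsGUCP φ' ∧ φ' ∘ₗ ι = φ

/-- `G`-essentiality of an extension `ι : S → U`. -/
def IsGEssential {S : GOperatorSystem.{u, v} G} {U : GOperatorSystem.{u, w} G}
    (ι : S.carrier →ₗ[ℂ] U.carrier) : Prop :=
  ∀ (T : GOperatorSystem.{u, w} G) (φ : U.carrier →ₗ[ℂ] T.carrier), IsGUCP φ →
    IsCompletelyIsometric (φ ∘ₗ ι) → IsCompletelyIsometric φ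

/-- `(U, ι)` is a `G`-injective envelope of `S`. -/
structure IsGInjectiveEnvelope {S : GOperatorSystem.{u, v} G} {U : GOperatorSystem.{u, w} G}
    (ι : S.carrier →ₗ[ℂ] U.carrier) : Prop where
  extension : IsGExtension ι
  injective : IsGInjective U
  essential : IsGEssential ι

variable (G)

/-- `ℂ` with the trivial `G`-action. -/
def complex : GOperatorSystem.{u, 0} G where
  Ambient := ℂ
  carrier := ⊤
  one_mem := trivial
  star_mem _ _ := trivial
  act := 1
  act_one _ := rfl
  act_completelyPositive _ _ _ h := h

variable (X : Type v) [TopologicalSpace X] [CompactSpace X] [MulAction G X]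
  [ContinuousConstSMul G X]

/-- The translation `(s f)(x) = f (s⁻¹ x)` on `C(X)`. -/
def translate {G : Type u} [Group G] (X : Type v) [TopologicalSpace X] [CompactSpace X]
    [MulAction G X] [ContinuousConstSMul G X] (s : G) : C(X, ℂ) →⋆ₐ[ℂ] C(X, ℂ) :=
  ContinuousMap.compStarAlgHom' ℂ ℂ ⟨fun x => s⁻¹ • x, continuous_const_smul s⁻¹⟩

/-- `C(X)` with the `G`-action induced by the `G`-action on the compact space `X`. -/
def continuousFunctions : GOperatorSystem.{u, v} G where
  Ambient := C(X, ℂ)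
  carrier := ⊤
  one_mem := trivial
  star_mem _ _ := trivial
  act :=
    { toFun := fun s =>
        { toFun := fun f => ⟨translate X s f.1, trivial⟩
          map_add' := fun f g => by ext x; rfl
          map_smul' := fun c f => by ext x; rfl }
      map_one' := by
        ext f x
        change f.1 ((1 : G)⁻¹ • x) = f.1 x
        rw [inv_one, one_smul]
      map_mul' := fun s t => by
        ext f x
        change f.1 ((s * t)⁻¹ • x) = f.1 (t⁻¹ • s⁻¹ • x)
        rw [mul_inv_rev, mul_smul] }
  act_one _ := rfl
  act_completelyPositive s n M h :=
    CompletelyPositiveMapClass.map_cstarMatrix_nonneg' (translate X s) n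
      (M.map (fun x => (x : C(X, ℂ)))) h

end GOperatorSystem

/-! ### Compact `G`-spaces

For a discrete group `G`, a compact `G`-space is a compact Hausdorff space with an action of `G` by
homeomorphisms, i.e. with instances `MulAction G X` and `ContinuousConstSMul G X`. -/

section Spaces

variable (G : Type u) [Group G]

/-- `X` is a Hamana boundary of `G`: `C(X)` with the induced action is a `G`-injective envelope of
`ℂ`. -/
def IsHamanaBoundary (X : Type v) [TopologicalSpace X] [CompactSpace X] [MulAction G X]
    [ContinuousConstSMul G X] : Prop :=
  ∃ ι : (GOperatorSystem.complex G).carrier →ₗ[ℂ]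
      (GOperatorSystem.continuousFunctions G X).carrier,
    GOperatorSystem.IsGInjectiveEnvelope ι

/-- Strong proximality: the weak* closure of the orbit of every (regular Borel) probability measure
contains a point mass. The topology on `ProbabilityMeasure X` is that of convergence of the
integrals of continuous functions. -/
def IsStronglyProximal (X : Type v) [TopologicalSpace X] [MulAction G X]
    [ContinuousConstSMul G X] : Prop :=
  letI : MeasurableSpace X := borel X
  haveI : BorelSpace X := ⟨rfl⟩
  ∀ ν : MeasureTheory.ProbabilityMeasure X, (ν : MeasureTheory.Measure X).Regular →
    ∃ x : X, MeasureTheory.diracProba x ∈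
      closure (Set.range fun s : G =>
        ν.map (f := fun y => s • y) (continuous_const_smul s).measurable.aemeasurable)

/-- A `G`-boundary: a nonempty compact Hausdorff `G`-space that is minimal and strongly proximal. -/
structure IsGBoundary (X : Type v) [TopologicalSpace X] [MulAction G X]
    [ContinuousConstSMul G X] : Prop where
  nonempty : Nonempty X
  compact : CompactSpace X
  hausdorff : T2Space X
  minimal : MulAction.IsMinimal G X
  stronglyProximal : IsStronglyProximal G X

/-- `Y` is a continuous `G`-equivariant image of `X`. -/
def IsGImage (X : Type v) [TopologicalSpace X] [MulAction G X]
    (Y : Type w) [TopologicalSpace Y] [MulAction G Y] : Prop :=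
  ∃ f : X → Y, Continuous f ∧ Function.Surjective f ∧ ∀ (s : G) (x : X), f (s • x) = s • f x

/-- `X` is a Furstenberg boundary of `G`: a `G`-boundary of which every `G`-boundary is a continuous
`G`-equivariant image. -/
def IsFurstenbergBoundary (X : Type v) [TopologicalSpace X] [MulAction G X]
    [ContinuousConstSMul G X] : Prop :=
  IsGBoundary G X ∧
    ∀ (B : Type v) [TopologicalSpace B] [MulAction G B] [ContinuousConstSMul G B],
      IsGBoundary G B → IsGImage G X B

end Spaces

/-! ### The algebra `ℓ^∞(G)` -/

/-- `ℓ^∞(G)`. -/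
abbrev EllInfty (G : Type u) : Type u := lp (fun _ : G => ℂ) ∞

namespace EllInfty

variable {G : Type u} [Group G]

/-- Left translation `(s f)(t) = f (s⁻¹ t)` on `ℓ^∞(G)`. -/
def translate (s : G) (f : EllInfty G) : EllInfty G :=
  ⟨fun t => f (s⁻¹ * t), by
    obtain ⟨C, hC⟩ := memℓp_infty_iff.1 (lp.memℓp f)
    refine memℓp_infty ⟨C, ?_⟩
    rintro _ ⟨t, rfl⟩
    exact hC ⟨s⁻¹ * t, rfl⟩⟩

/-- A unital positive `G`-equivariant projection on `ℓ^∞(G)`. -/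
structure IsGProjection (ψ : EllInfty G →ₗ[ℂ] EllInfty G) : Prop where
  unital : ψ 1 = 1
  positive : ∀ f : EllInfty G, (∀ t, 0 ≤ f t) → ∀ t, 0 ≤ ψ f t
  equivariant : ∀ (s : G) (f : EllInfty G), ψ (translate s f) = translate s (ψ f)
  idempotent : ∀ f : EllInfty G, ψ (ψ f) = ψ f

/-- A unital positive `G`-equivariant projection whose image is minimal under inclusion among the
images of all such projections. -/
structure IsMinimalGProjection (ψ : EllInfty G →ₗ[ℂ] EllInfty G) : Prop where
  projection : IsGProjection ψ
  minimal : ∀ ψ' : EllInfty G →ₗ[ℂ] EllInfty G, IsGProjection ψ' →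
    LinearMap.range ψ' ≤ LinearMap.range ψ → LinearMap.range ψ' = LinearMap.range ψ

/-- `j` identifies the C*-algebra `C(X)`, `G`-equivariantly and isometrically, with the image of
the projection `ψ` on `ℓ^∞(G)`, where the image carries the Choi-Effros product
`a · b = ψ (a b)`. -/
structure IsImageIso {X : Type v} [TopologicalSpace X] [CompactSpace X] [MulAction G X]
    [ContinuousConstSMul G X] (ψ : EllInfty G →ₗ[ℂ] EllInfty G)
    (j : C(X, ℂ) →ₗ[ℂ] EllInfty G) : Prop where
  range_eq : LinearMap.range j = LinearMap.range ψ
  norm_map : ∀ f, ‖j f‖ = ‖f‖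
  map_one : j 1 = 1
  map_star : ∀ f, j (star f) = star (j f)
  map_mul : ∀ f g, j (f * g) = ψ (j f * j g)
  equivariant : ∀ (s : G) (f : C(X, ℂ)),
    j (GOperatorSystem.translate X s f) = translate s (j f)

end EllInfty

/-- `G` is amenable: there is a left-invariant mean, i.e. a unital positive linear functional on
`ℓ^∞(G)` that is invariant under left translation. -/
def IsAmenable (G : Type u) [Group G] : Prop :=
  ∃ m : EllInfty G →ₗ[ℂ] ℂ, m 1 = 1 ∧ (∀ f : EllInfty G, (∀ t, 0 ≤ f t) → 0 ≤ m f) ∧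
    ∀ (s : G) (f : EllInfty G), m (EllInfty.translate s f) = m f

end

/-!
The algebra `ℓ^∞(G)` is a universal target: an equivariant map `Φ : T → ℓ^∞(G)` is determined by the
functional `τ = Φ(·)(1)`, since `Φ(x)(t) = τ(t⁻¹ x)`, and it is unital and completely positive as
soon as `τ` is a state. So extending `Φ` amounts to extending `τ`, and every unital completely
positive equivariant retract of `ℓ^∞(G)` is `G`-injective. Such a retract `C(X)` is moreover an
envelope of `ℂ` exactly when it is rigid, that is, when its only unital positive equivariant
self-map is the identity.

Let `K` be a minimal closed convex invariant set of states of `ℓ^∞(G)`. The orbit closure `X` of an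
extreme point of `K` is minimal; it is strongly proximal, because the closure of the orbit of the
barycenter of any measure on `X` contains that extreme point. Strong proximality turns equivariant
maps `C(B) → C(X)` into maps `X → B`, which makes `C(X)` rigid and gives the maps onto all
boundaries.
-/

noncomputable section

/-! ### States -/

section States

open Complex ComplexStarModule

/-- Unital positive linear maps of ordered algebras. -/
structure IsUnitalPositive {A B : Type*} [Semiring A] [PartialOrder A] [Module ℂ A]
    [Semiring B] [PartialOrder B] [Module ℂ B] (φ : A →ₗ[ℂ] B) : Prop where
  map_one : φ 1 = 1
  map_nonneg : ∀ a, 0 ≤ a → 0 ≤ φ a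

namespace IsUnitalPositive

variable {A B C : Type*} [Semiring A] [PartialOrder A] [Module ℂ A]
  [Semiring B] [PartialOrder B] [Module ℂ B] [Semiring C] [PartialOrder C] [Module ℂ C]

theorem id : IsUnitalPositive (LinearMap.id : A →ₗ[ℂ] A) := ⟨rfl, fun _ h => h⟩

theorem comp {ψ : B →ₗ[ℂ] C} {φ : A →ₗ[ℂ] B} (hψ : IsUnitalPositive ψ) (hφ : IsUnitalPositive φ) :
    IsUnitalPositive (ψ ∘ₗ φ) :=
  ⟨by rw [LinearMap.comp_apply, hφ.map_one, hψ.map_one],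
    fun a ha => hψ.map_nonneg _ (hφ.map_nonneg a ha)⟩

end IsUnitalPositive

theorem isUnitalPositive_starAlgHom {A B : Type*} [CStarAlgebra A] [PartialOrder A]
    [StarOrderedRing A] [CStarAlgebra B] [PartialOrder B] [StarOrderedRing B] (φ : A →⋆ₐ[ℂ] B) :
    IsUnitalPositive (φ : A →ₗ[ℂ] B) :=
  ⟨map_one φ, fun _ ha => map_nonneg φ ha⟩

variable {A : Type*} [CStarAlgebra A]

theorem norm_add_I_smul_one_sq_le {a : A} (ha : IsSelfAdjoint a) (t : ℝ) :
    ‖a + (t * I : ℂ) • (1 : A)‖ ^ 2 ≤ ‖a‖ ^ 2 + t ^ 2 * ‖(1 : A)‖ := by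
  have hstar : star (t * I : ℂ) = -(t * I) := by simp
  have h : star (a + (t * I : ℂ) • (1 : A)) * (a + (t * I : ℂ) • (1 : A)) =
      a * a + (-(t * I * (t * I)) : ℂ) • (1 : A) := by
    simp only [star_add, star_smul, hstar, ha.star_eq, star_one, add_mul, mul_add, mul_smul_comm,
      smul_mul_assoc, mul_one, one_mul, smul_add]
    module
  rw [sq, ← CStarRing.norm_star_mul_self, h]
  refine (norm_add_le _ _).trans (add_le_add ((norm_mul_le _ _).trans_eq (sq _).symm) ?_)
  simp [norm_smul, sq]

theorem im_apply_eq_zero_of_norm_apply_le {τ : A →ₗ[ℂ] ℂ} (h1 : τ 1 = 1)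
    (hτ : ∀ a, ‖τ a‖ ≤ ‖a‖) {a : A} (ha : IsSelfAdjoint a) : (τ a).im = 0 := by
  have : Nontrivial A := ⟨1, 0, fun h => by simp [h] at h1⟩
  -- `|τ a + i t|² ≤ ‖a‖² + t²` for all real `t` bounds the linear term `2 t Im (τ a)`
  have hquad (t : ℝ) : (τ a).im ^ 2 + 2 * (τ a).im * t ≤ ‖a‖ ^ 2 := by
    have h : ‖τ (a + (t * I : ℂ) • (1 : A))‖ ^ 2 ≤ ‖a‖ ^ 2 + t ^ 2 * ‖(1 : A)‖ :=
      le_trans (by gcongr; exact hτ _) (norm_add_I_smul_one_sq_le ha t)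
    rw [map_add, map_smul, h1, ← normSq_eq_norm_sq, normSq_apply, CStarRing.norm_one,
      mul_one, smul_eq_mul, mul_one] at h
    simp only [add_re, add_im, mul_re, mul_im, ofReal_re, ofReal_im, I_re, I_im] at h
    nlinarith [sq_nonneg (τ a).re]
  by_contra hne
  have := hquad ((‖a‖ ^ 2 + 1) / (2 * (τ a).im))
  field_simp at this
  nlinarith [sq_nonneg (τ a).im]

variable {V : Type*} [AddCommGroup V] [Module ℂ V]

theorem exists_comp_eq_of_norm_apply_le {j : V →ₗ[ℂ] A} {σ : V →ₗ[ℂ] ℂ}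
    (hσ : ∀ v, ‖σ v‖ ≤ ‖j v‖) : ∃ τ : A →ₗ[ℂ] ℂ, (∀ a, ‖τ a‖ ≤ ‖a‖) ∧ τ ∘ₗ j = σ := by
  have hker : j.ker ≤ σ.ker := fun v hv => by simpa [LinearMap.mem_ker.1 hv] using hσ v
  let σ₀ : j.range →ₗ[ℂ] ℂ := j.ker.liftQ σ hker ∘ₗ j.quotKerEquivRange.symm
  have hσ₀ (v : V) : σ₀ ⟨j v, v, rfl⟩ = σ v :=
    congrArg (j.ker.liftQ σ hker) (j.quotKerEquivRange_symm_apply_image v _)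
  have hσ₀le (w : j.range) : ‖σ₀ w‖ ≤ 1 * ‖w‖ := by
    obtain ⟨_, v, rfl⟩ := w
    rw [hσ₀, one_mul]
    exact hσ v
  obtain ⟨τ, hτ, hnorm⟩ := exists_extension_norm_eq j.range (σ₀.mkContinuous 1 hσ₀le)
  refine ⟨τ.toLinearMap, fun a => ?_, LinearMap.ext fun v => (hτ ⟨j v, v, rfl⟩).trans (hσ₀ v)⟩
  rw [← one_mul ‖a‖]
  exact τ.le_of_opNorm_le (hnorm ▸ σ₀.mkContinuous_norm_le zero_le_one hσ₀le) a

/-- `j` presents `V` as an operator system in `A`: its image is a unital self-adjoint subspace.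
The map `j` need not be injective, so that an operator system can also be probed through a linear
map defined on it. -/
structure IsOperatorSystem (j : V →ₗ[ℂ] A) : Prop where
  exists_map_eq_one : ∃ u, j u = 1
  exists_map_eq_star : ∀ v, ∃ w, j w = star (j v)

theorem isOperatorSystem_id : IsOperatorSystem (LinearMap.id : A →ₗ[ℂ] A) :=
  ⟨⟨1, rfl⟩, fun a => ⟨star a, rfl⟩⟩

variable [PartialOrder A]

/-- States on the operator system `j`: unital functionals that are positive with respect to the
order of `A`. -/
structure IsState (j : V →ₗ[ℂ] A) (σ : V →ₗ[ℂ] ℂ) : Prop where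
  map_eq_one : ∀ u, j u = 1 → σ u = 1
  map_nonneg : ∀ v, 0 ≤ j v → 0 ≤ σ v

theorem IsUnitalPositive.isState {τ : A →ₗ[ℂ] ℂ} (hτ : IsUnitalPositive τ) :
    IsState LinearMap.id τ :=
  ⟨fun _ hu => (congrArg τ hu).trans hτ.map_one, hτ.map_nonneg⟩

variable [StarOrderedRing A]

namespace IsState

variable {j : V →ₗ[ℂ] A} {σ : V →ₗ[ℂ] ℂ}

theorem apply_le_norm (hj : IsOperatorSystem j) (hσ : IsState j σ) {v : V}
    (hv : IsSelfAdjoint (j v)) : σ v ≤ (‖j v‖ : ℂ) := by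
  obtain ⟨u, hu⟩ := hj.exists_map_eq_one
  have h : 0 ≤ σ ((‖j v‖ : ℂ) • u - v) := hσ.map_nonneg _ <| by
    simpa [hu, Algebra.algebraMap_eq_smul_one] using hv.le_algebraMap_norm_self
  simpa [hσ.map_eq_one u hu] using h

theorem im_apply_eq_zero (hj : IsOperatorSystem j) (hσ : IsState j σ) {v : V}
    (hv : IsSelfAdjoint (j v)) : (σ v).im = 0 := by
  simpa using (Complex.le_def.1 (hσ.apply_le_norm hj hv)).2

theorem apply_star (hj : IsOperatorSystem j) (hσ : IsState j σ) {v w : V}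
    (hw : j w = star (j v)) : σ w = star (σ v) := by
  have hadd := hσ.im_apply_eq_zero hj (v := v + w) (by simp [hw])
  have hsub := hσ.im_apply_eq_zero hj (v := I • (v - w))
    (by simp [hw, IsSelfAdjoint, star_smul, ← smul_neg])
  simp only [map_add, map_smul, map_sub, add_im, smul_eq_mul, I_mul_im, sub_re] at hadd hsub
  apply Complex.ext
  · simpa using (sub_eq_zero.1 hsub).symm
  · simpa using eq_neg_of_add_eq_zero_right hadd

theorem norm_apply_le (hj : IsOperatorSystem j) (hσ : IsState j σ) (v : V) :
    ‖σ v‖ ≤ ‖j v‖ := by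
  obtain ⟨c, hc, hcv⟩ := Complex.exists_norm_eq_mul_self (σ v)
  obtain ⟨w, hw⟩ := hj.exists_map_eq_star (c • v)
  have hre : j ((1 / 2 : ℂ) • (c • v + w)) = ℜ (j (c • v)) := by
    rw [map_smul, map_add, hw, realPart_apply_coe, ← coe_smul]
    norm_num
  have hσre : σ ((1 / 2 : ℂ) • (c • v + w)) = ‖σ v‖ := by
    rw [map_smul, map_add, hσ.apply_star hj hw, map_smul, smul_eq_mul c, ← hcv, star_def,
      conj_ofReal, smul_eq_mul]
    ring
  have h := hσ.apply_le_norm hj (hre ▸ (ℜ (j (c • v))).2)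
  rw [hσre, hre, real_le_real] at h
  calc ‖σ v‖ ≤ ‖ℜ (j (c • v))‖ := h
    _ ≤ ‖j (c • v)‖ := realPart.norm_le _
    _ = ‖j v‖ := by rw [map_smul, norm_smul, hc, one_mul]

end IsState

theorem IsUnitalPositive.of_norm_apply_le {τ : A →ₗ[ℂ] ℂ} (h1 : τ 1 = 1)
    (hτ : ∀ a, ‖τ a‖ ≤ ‖a‖) : IsUnitalPositive τ := by
  refine ⟨h1, fun a ha => ?_⟩
  have hsa : IsSelfAdjoint a := .of_nonneg ha
  have hle : ‖algebraMap ℝ A ‖a‖ - a‖ ≤ ‖a‖ :=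
    ((CStarAlgebra.mem_Icc_algebraMap_iff_norm_le (norm_nonneg a)).1
      ⟨sub_nonneg.2 hsa.le_algebraMap_norm_self, sub_le_self _ ha⟩).2
  have hτle : ‖(‖a‖ : ℂ) - τ a‖ ≤ ‖a‖ := by
    refine le_trans (le_of_eq ?_) ((hτ _).trans hle)
    rw [map_sub, Algebra.algebraMap_eq_smul_one, ← coe_smul, map_smul, h1, smul_eq_mul, mul_one]
  refine Complex.nonneg_iff.2 ⟨?_, (im_apply_eq_zero_of_norm_apply_le h1 hτ hsa).symm⟩
  simpa using (re_le_norm _).trans hτle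

theorem exists_isUnitalPositive_comp_eq {j : V →ₗ[ℂ] A} {σ : V →ₗ[ℂ] ℂ} {u : V} (hju : j u = 1)
    (hσu : σ u = 1) (hσ : ∀ v, ‖σ v‖ ≤ ‖j v‖) :
    ∃ τ : A →ₗ[ℂ] ℂ, IsUnitalPositive τ ∧ τ ∘ₗ j = σ := by
  obtain ⟨τ, hτ, rfl⟩ := exists_comp_eq_of_norm_apply_le hσ
  exact ⟨τ, .of_norm_apply_le (by rw [← hju]; exact hσu) hτ, rfl⟩

end States

section CommutativeTarget

variable {A B : Type*} [CStarAlgebra A] [PartialOrder A] [StarOrderedRing A]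

namespace IsUnitalPositive

section Scalar

variable {τ : A →ₗ[ℂ] ℂ}

theorem apply_star (hτ : IsUnitalPositive τ) (a : A) : τ (star a) = star (τ a) :=
  hτ.isState.apply_star isOperatorSystem_id rfl

theorem norm_apply_le_norm (hτ : IsUnitalPositive τ) (a : A) : ‖τ a‖ ≤ ‖a‖ :=
  hτ.isState.norm_apply_le isOperatorSystem_id a

theorem star_apply_mul_apply_le (hτ : IsUnitalPositive τ) (a : A) :
    star (τ a) * τ a ≤ τ (star a * a) := by
  have h := hτ.map_nonneg _ (star_mul_self_nonneg (a - τ a • (1 : A)))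
  have hexpand : star (a - τ a • (1 : A)) * (a - τ a • (1 : A)) =
      star a * a - star (τ a) • a - τ a • star a + (star (τ a) * τ a) • (1 : A) := by
    simp only [star_sub, star_smul, star_one, sub_mul, mul_sub, mul_smul_comm, smul_mul_assoc,
      mul_one, one_mul]
    module
  have hvalue : τ (star (a - τ a • (1 : A)) * (a - τ a • (1 : A))) =
      τ (star a * a) - star (τ a) * τ a := by
    rw [hexpand]
    simp only [map_add, map_sub, map_smul, hτ.apply_star, hτ.map_one, smul_eq_mul]
    ring
  exact sub_nonneg.1 (hvalue ▸ h)

end Scalar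

end IsUnitalPositive

open WeakDual

theorem isUnitalPositive_character (χ : characterSpace ℂ A) :
    IsUnitalPositive (χ : A →ₗ[ℂ] ℂ) :=
  ⟨map_one χ, fun _ hb => map_nonneg χ hb⟩

variable [CommCStarAlgebra B]

theorem eq_of_forall_character_eq {a b : B} (h : ∀ χ : characterSpace ℂ B, χ a = χ b) : a = b :=
  (gelfandStarTransform B).injective (ContinuousMap.ext h)

variable [PartialOrder B] [StarOrderedRing B]

theorem le_of_forall_character_le {a b : B} (h : ∀ χ : characterSpace ℂ B, χ a ≤ χ b) : a ≤ b := by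
  have := map_nonneg (gelfandStarTransform B).symm (a := gelfandTransform ℂ B (b - a)) fun χ =>
    (sub_nonneg.2 (h χ)).trans_eq (map_sub χ b a).symm
  rwa [← sub_nonneg, ← (gelfandStarTransform B).symm_apply_apply (b - a)]

namespace IsUnitalPositive

variable {φ : A →ₗ[ℂ] B}

protected theorem map_star (hφ : IsUnitalPositive φ) (a : A) : φ (star a) = star (φ a) :=
  eq_of_forall_character_eq fun χ => by
    rw [StarHomClass.map_star χ]
    exact ((isUnitalPositive_character χ).comp hφ).apply_star a

theorem norm_map_le (hφ : IsUnitalPositive φ) (a : A) : ‖φ a‖ ≤ ‖a‖ := by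
  rw [← (gelfandTransform_isometry B).norm_map_of_map_zero (map_zero _)]
  exact (ContinuousMap.norm_le _ (norm_nonneg a)).2 fun χ =>
    ((isUnitalPositive_character χ).comp hφ).norm_apply_le_norm a

theorem star_map_mul_map_le (hφ : IsUnitalPositive φ) (a : A) :
    star (φ a) * φ a ≤ φ (star a * a) :=
  le_of_forall_character_le fun χ => by
    rw [map_mul, StarHomClass.map_star χ]
    exact ((isUnitalPositive_character χ).comp hφ).star_apply_mul_apply_le a

end IsUnitalPositive

end CommutativeTarget

/-- In terms of the projection `α ∘ β`, the product recovered here is the Choi–Effros product. -/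
theorem IsUnitalPositive.map_mul_of_comp_eq_id {A B : Type*} [CommCStarAlgebra A] [PartialOrder A]
    [StarOrderedRing A] [CommCStarAlgebra B] [PartialOrder B] [StarOrderedRing B] {α : A →ₗ[ℂ] B}
    {β : B →ₗ[ℂ] A} (hα : IsUnitalPositive α) (hβ : IsUnitalPositive β)
    (h : β ∘ₗ α = LinearMap.id) (f g : A) : β (α f * α g) = f * g := by
  have hβα (f : A) : β (α f) = f := LinearMap.congr_fun h f
  have hdiag (f : A) : β (star (α f) * α f) = star f * f := by
    refine le_antisymm ?_ ?_
    · have := hβ.map_nonneg _ (sub_nonneg.2 (hα.star_map_mul_map_le f))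
      rwa [map_sub, hβα, sub_nonneg] at this
    · simpa only [hβα] using hβ.star_map_mul_map_le (α f)
  have hpolar (f g : A) :
      β (star (α f) * α g) + β (star (α g) * α f) = star f * g + star g * f := by
    have := hdiag (f + g)
    simp only [map_add, star_add, add_mul, mul_add, hdiag] at this
    linear_combination this
  have hskew (f g : A) :
      β (star (α f) * α g) - β (star (α g) * α f) = star f * g - star g * f := by
    have := hpolar f (Complex.I • g)
    simp only [map_smul, star_smul, Complex.star_def, Complex.conj_I, mul_smul_comm,
      smul_mul_assoc, neg_smul, neg_mul, map_neg, ← sub_eq_add_neg, ← smul_sub] at this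
    exact smul_right_injective A Complex.I_ne_zero this
  have hdouble : (2 : ℂ) • β (α f * α g) = (2 : ℂ) • (f * g) := by
    have hpolar' := hpolar (star f) g
    have hskew' := hskew (star f) g
    rw [hα.map_star, star_star, star_star] at hpolar' hskew'
    rw [two_smul, two_smul]
    linear_combination hpolar' + hskew'
  exact smul_right_injective A two_ne_zero hdouble

section Matrices

open CStarMatrix

theorem exists_eq_star_mul_self_of_nonneg {B : Type*} [NonUnitalCStarAlgebra B] [PartialOrder B]
    [StarOrderedRing B] {b : B} (hb : 0 ≤ b) : ∃ d, b = star d * d :=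
  CStarAlgebra.nonneg_iff_eq_star_mul_self.1 hb

theorem nonneg_of_forall_map_nonneg {ι B D : Type*} [NonUnitalCStarAlgebra B] [PartialOrder B]
    [StarOrderedRing B] [NonUnitalCStarAlgebra D] [PartialOrder D] [StarOrderedRing D]
    (ev : ι → B →⋆ₙₐ[ℂ] D) (hinj : ∀ b, (∀ x, ev x b = 0) → b = 0) {b : B}
    (h : ∀ x, 0 ≤ ev x b) : 0 ≤ b := by
  have hsa : IsSelfAdjoint b := sub_eq_zero.1 <| hinj _ fun x => by
    rw [map_sub, map_star, (IsSelfAdjoint.of_nonneg (h x)).star_eq, sub_self]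
  have hneg : b⁻ = 0 := hinj _ fun x => by
    have hmap : ev x b⁻ = (ev x b)⁻ := by
      exact (ev x).map_cfcₙ (·⁻ : ℝ → ℝ) b (hφ := map_continuous (ev x)) (hφa := hsa.map (ev x))
    rw [hmap, CFC.negPart_eq_zero_iff _ (.of_nonneg (h x))]
    exact h x
  exact (CFC.negPart_eq_zero_iff b hsa).1 hneg

section Blocks

variable {A B : Type*} {n : Type*}

/-- The `2 × 2` block matrix with the given blocks. -/
def ofBlocks (a b c d : CStarMatrix n n A) : CStarMatrix (n ⊕ n) (n ⊕ n) A :=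
  ofMatrix (Matrix.fromBlocks (ofMatrix.symm a) (ofMatrix.symm b) (ofMatrix.symm c)
    (ofMatrix.symm d))

theorem map_ofBlocks (a b c d : CStarMatrix n n A) (f : A → B) :
    (ofBlocks a b c d).map f = ofBlocks (a.map f) (b.map f) (c.map f) (d.map f) :=
  Matrix.fromBlocks_map _ _ _ _ _

theorem ofBlocks_inj {a b c d a' b' c' d' : CStarMatrix n n A} :
    ofBlocks a b c d = ofBlocks a' b' c' d' ↔ a = a' ∧ b = b' ∧ c = c' ∧ d = d' :=
  Matrix.fromBlocks_inj

theorem exists_eq_ofBlocks (M : CStarMatrix (n ⊕ n) (n ⊕ n) A) :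
    ∃ a b c d, M = ofBlocks a b c d :=
  ⟨_, _, _, _, (Matrix.fromBlocks_toBlocks M).symm⟩

variable [CStarAlgebra A]

theorem ofBlocks_mul [Fintype n] (a b c d a' b' c' d' : CStarMatrix n n A) :
    ofBlocks a b c d * ofBlocks a' b' c' d' =
      ofBlocks (a * a' + b * c') (a * b' + b * d') (c * a' + d * c') (c * b' + d * d') :=
  Matrix.fromBlocks_multiply _ _ _ _ _ _ _ _

theorem star_ofBlocks (a b c d : CStarMatrix n n A) :
    star (ofBlocks a b c d) = ofBlocks (star a) (star c) (star b) (star d) :=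
  Matrix.fromBlocks_conjTranspose _ _ _ _

variable [PartialOrder A] [StarOrderedRing A] [Fintype n] [DecidableEq n]

theorem ofBlocks_nonneg_of_norm_le_one {a : CStarMatrix n n A} (ha : ‖a‖ ≤ 1) :
    0 ≤ ofBlocks 1 a (star a) 1 := by
  have h : 0 ≤ 1 - star a * a := by
    rw [sub_nonneg, ← CStarAlgebra.norm_le_one_iff_of_nonneg _ (star_mul_self_nonneg a),
      CStarRing.norm_star_mul_self]
    exact mul_le_one₀ ha (norm_nonneg a) ha
  obtain ⟨d, hd⟩ := exists_eq_star_mul_self_of_nonneg h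
  have hfactor : ofBlocks 1 a (star a) 1 = star (ofBlocks 1 a 0 d) * ofBlocks 1 a 0 d := by
    simp [star_ofBlocks, ofBlocks_mul, ← hd]
  exact hfactor ▸ star_mul_self_nonneg _

theorem norm_le_one_of_ofBlocks_nonneg {a b : CStarMatrix n n A}
    (h : 0 ≤ ofBlocks 1 a b 1) : ‖a‖ ≤ 1 := by
  obtain rfl : b = star a := by
    have := (IsSelfAdjoint.of_nonneg h).star_eq
    rw [star_ofBlocks, ofBlocks_inj] at this
    exact this.2.2.1.symm
  -- conjugating by `[0, -a; 0, 1]` leaves `1 - a⋆ a` in the lower right corner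
  have hconj := star_left_conjugate_nonneg h (ofBlocks 0 (-a) 0 1)
  obtain ⟨e, he⟩ := exists_eq_star_mul_self_of_nonneg hconj
  obtain ⟨p, q, r, s, rfl⟩ := exists_eq_ofBlocks e
  simp only [star_ofBlocks, ofBlocks_mul, ofBlocks_inj] at he
  have hcorner : 1 - star a * a = star q * q + star s * s := by
    rw [← he.2.2.2]
    simp [sub_eq_add_neg, add_comm]
  have hle : star a * a ≤ 1 := sub_nonneg.1 <|
    hcorner ▸ add_nonneg (star_mul_self_nonneg q) (star_mul_self_nonneg s)
  rw [← CStarAlgebra.norm_le_one_iff_of_nonneg _ (star_mul_self_nonneg a),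
    CStarRing.norm_star_mul_self, ← sq] at hle
  exact (sq_le_one_iff₀ (norm_nonneg a)).1 hle

end Blocks

section CompletePositivity

variable {A : Type*} [CStarAlgebra A] [PartialOrder A] [StarOrderedRing A]
  {n : Type*} [Fintype n]

theorem cstarMatrix_nonneg_of_posSemidef {M : CStarMatrix n n ℂ}
    (h : (ofMatrix.symm M).PosSemidef) : 0 ≤ M := by
  classical
  open scoped MatrixOrder in
  obtain ⟨B, hB⟩ := CStarAlgebra.nonneg_iff_eq_star_mul_self.1 h.nonneg
  have hM : M = star (ofMatrix B) * ofMatrix B := hB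
  exact hM ▸ star_mul_self_nonneg _

theorem nonneg_of_forall_eval_nonneg {X : Type*} [TopologicalSpace X] [CompactSpace X]
    {M : CStarMatrix n n C(X, ℂ)} (h : ∀ x, 0 ≤ M.map (fun f => f x)) : 0 ≤ M := by
  let ev (x : X) : CStarMatrix n n C(X, ℂ) →⋆ₙₐ[ℂ] CStarMatrix n n ℂ :=
    mapₙₐ (ContinuousMap.evalStarAlgHom ℂ ℂ x : C(X, ℂ) →⋆ₙₐ[ℂ] ℂ)
  refine nonneg_of_forall_map_nonneg ev (fun N hN => ?_) h
  ext i j x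
  exact congrFun (congrFun (hN x) i) j

theorem sum_star_mul_smul_nonneg {M : CStarMatrix n n A} (hM : 0 ≤ M) (c : n → ℂ) :
    0 ≤ ∑ i, ∑ j, (star (c i) * c j) • M i j := by
  obtain ⟨E, rfl⟩ := exists_eq_star_mul_self_of_nonneg hM
  have hsum : ∑ i, ∑ j, (star (c i) * c j) • (star E * E) i j =
      ∑ k, star (∑ i, c i • E k i) * ∑ j, c j • E k j := by
    simp only [mul_apply, star_apply, star_sum, star_smul, Finset.smul_sum, Finset.sum_mul_sum,
      smul_mul_smul_comm]
    exact (Finset.sum_congr rfl fun i _ => Finset.sum_comm).trans Finset.sum_comm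
  exact hsum ▸ Finset.sum_nonneg fun k _ => star_mul_self_nonneg _

variable {V : Type*} [AddCommGroup V] [Module ℂ V] {j : V →ₗ[ℂ] A}

theorem IsState.map_cstarMatrix_nonneg {σ : V →ₗ[ℂ] ℂ} (hj : IsOperatorSystem j)
    (hσ : IsState j σ) {M : CStarMatrix n n V} (hM : 0 ≤ M.map j) : 0 ≤ M.map σ := by
  refine cstarMatrix_nonneg_of_posSemidef (.of_dotProduct_mulVec_nonneg ?_ fun c => ?_)
  · ext k l
    have hkl : star (M.map j) k l = M.map j k l :=
      congrFun (congrFun (IsSelfAdjoint.of_nonneg hM).star_eq k) l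
    exact (hσ.apply_star hj (v := M l k) (w := M k l) hkl.symm).symm
  · have h : 0 ≤ σ (∑ k, ∑ l, (star (c k) * c l) • M k l) := hσ.map_nonneg _ <| by
      simpa only [map_sum, map_smul] using! sum_star_mul_smul_nonneg hM c
    convert h using 1
    simp only [dotProduct, Matrix.mulVec, Finset.mul_sum, map_sum, map_smul, smul_eq_mul,
      mul_assoc, mul_comm (c _)]
    rfl

theorem map_nonneg_of_forall_isState {X : Type*} [TopologicalSpace X] [CompactSpace X]
    (hj : IsOperatorSystem j) {φ : V →ₗ[ℂ] C(X, ℂ)}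
    (hφ : ∀ x, IsState j ((ContinuousMap.evalCLM ℂ x).toLinearMap ∘ₗ φ)) {M : CStarMatrix n n V}
    (hM : 0 ≤ M.map j) : 0 ≤ M.map φ :=
  nonneg_of_forall_eval_nonneg fun x => (hφ x).map_cstarMatrix_nonneg hj hM

end CompletePositivity

section CompleteContractivity

variable {A B V : Type*} [CStarAlgebra A] [PartialOrder A] [StarOrderedRing A]
  [CStarAlgebra B] [PartialOrder B] [StarOrderedRing B] [AddCommGroup V] [Module ℂ V]
  {j : V →ₗ[ℂ] A} {k : V →ₗ[ℂ] B}

theorem map_nonneg_of_forall_fin {R n : Type*} [Fintype n] {f : R → A} {g : R → B}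
    (h : ∀ (r : ℕ) (M : CStarMatrix (Fin r) (Fin r) R), 0 ≤ M.map f → 0 ≤ M.map g)
    {M : CStarMatrix n n R} (hM : 0 ≤ M.map f) : 0 ≤ M.map g := by
  let e := Fintype.equivFin n
  have hg := h _ (fun a b => M (e.symm a) (e.symm b)) (map_nonneg (reindexₐ ℂ A e) hM)
  convert map_nonneg (reindexₐ ℂ B e.symm) hg using 1
  ext a b
  change g (M a b) = g (M (e.symm (e a)) (e.symm (e b)))
  rw [e.symm_apply_apply, e.symm_apply_apply]

theorem norm_apply_le_norm_apply {E F : Type*} [NormedAddCommGroup E] [NormedSpace ℂ E]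
    [NormedAddCommGroup F] [NormedSpace ℂ F] {α : V →ₗ[ℂ] E} {β : V →ₗ[ℂ] F}
    (h : ∀ v, ‖α v‖ ≤ 1 → ‖β v‖ ≤ 1) (v : V) : ‖β v‖ ≤ ‖α v‖ := by
  refine le_of_forall_gt_imp_ge_of_dense fun r hr => ?_
  have hr0 : 0 < r := (norm_nonneg _).trans_lt hr
  have hscale := h ((r⁻¹ : ℂ) • v)
  simp only [map_smul, norm_smul, norm_inv, Complex.norm_real, Real.norm_of_nonneg hr0.le,
    inv_mul_le_iff₀ hr0, mul_one] at hscale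
  exact hscale hr.le

theorem norm_map_le_of_forall_map_nonneg {n : Type*} [Fintype n] (hj : IsOperatorSystem j)
    (hunit : ∀ u, j u = 1 → k u = 1)
    (hpos : ∀ M : CStarMatrix (n ⊕ n) (n ⊕ n) V, 0 ≤ M.map j → 0 ≤ M.map k)
    (M : CStarMatrix n n V) : ‖M.map k‖ ≤ ‖M.map j‖ := by
  classical
  obtain ⟨u, hu⟩ := hj.exists_map_eq_one
  choose adj hadj using hj.exists_map_eq_star
  let I : CStarMatrix n n V := ofMatrix (Matrix.diagonal fun _ => u)
  have hIj : I.map j = 1 := by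
    ext a b
    simp [I, Matrix.diagonal_apply, one_apply, apply_ite j, hu]
  have hIk : I.map k = 1 := by
    ext a b
    simp [I, Matrix.diagonal_apply, one_apply, apply_ite k, hunit u hu]
  refine norm_apply_le_norm_apply (α := mapₗ j) (β := mapₗ k) (fun M hM => ?_) M
  let M' : CStarMatrix n n V := fun a b => adj (M b a)
  have hM' : M'.map j = star (M.map j) := by
    ext a b
    exact hadj (M b a)
  have h := hpos (ofBlocks I M M' I) <| by
    rw [map_ofBlocks, hIj, hM']
    exact ofBlocks_nonneg_of_norm_le_one hM
  rw [map_ofBlocks, hIk] at h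
  exact norm_le_one_of_ofBlocks_nonneg h

end CompleteContractivity

section OneByOne

variable {A : Type*} [CStarAlgebra A] [PartialOrder A] [StarOrderedRing A] {R : Type*}

theorem norm_map_oneByOne (a : R) (f : R → A) :
    ‖CStarMatrix.map (fun _ _ => a : CStarMatrix (Fin 1) (Fin 1) R) f‖ = ‖f a‖ :=
  let e : A ≃⋆ₐ[ℂ] CStarMatrix (Fin 1) (Fin 1) A := toOneByOne (Fin 1) ℂ A
  StarAlgEquiv.norm_map e (f a)

theorem map_oneByOne_nonneg_iff (a : R) (f : R → A) :
    0 ≤ CStarMatrix.map (fun _ _ => a : CStarMatrix (Fin 1) (Fin 1) R) f ↔ 0 ≤ f a :=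
  let e : A ≃⋆ₐ[ℂ] CStarMatrix (Fin 1) (Fin 1) A := toOneByOne (Fin 1) ℂ A
  ⟨fun h => map_nonneg e.symm h, fun h => map_nonneg e h⟩

end OneByOne

end Matrices

namespace EllInfty

variable {G : Type u}

theorem ext {f g : EllInfty G} (h : ∀ t, f t = g t) : f = g :=
  lp.ext (funext h)

/-- The pointwise order on `ℓ^∞(G)`. -/
instance : PartialOrder (EllInfty G) :=
  PartialOrder.lift (fun f => (f : G → ℂ)) fun _ _ h => lp.ext h

theorem exists_eq_star_mul_self_of_forall_nonneg {f : EllInfty G} (hf : ∀ t, 0 ≤ f t) :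
    ∃ g : EllInfty G, f = star g * g := by
  have hmem : Memℓp (fun t => (√(f t).re : ℂ)) ∞ := by
    refine memℓp_infty ⟨√‖f‖, ?_⟩
    rintro _ ⟨t, rfl⟩
    change ‖(√(f t).re : ℂ)‖ ≤ √‖f‖
    rw [Complex.norm_real, Real.norm_of_nonneg (Real.sqrt_nonneg _)]
    exact Real.sqrt_le_sqrt ((Complex.re_le_norm _).trans (lp.norm_apply_le_norm (by simp) f t))
  refine ⟨⟨_, hmem⟩, ext fun t => ?_⟩
  obtain ⟨hre, him⟩ := Complex.nonneg_iff.1 (hf t)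
  change f t = star (√(f t).re : ℂ) * (√(f t).re : ℂ)
  rw [Complex.star_def, Complex.conj_ofReal, ← Complex.ofReal_mul, Real.mul_self_sqrt hre]
  exact Complex.ext rfl him.symm

instance : StarOrderedRing (EllInfty G) :=
  .of_nonneg_iff' (fun {_ _} h z t => add_le_add_right (h t) (z t)) fun _ =>
    ⟨exists_eq_star_mul_self_of_forall_nonneg, fun ⟨g, hg⟩ t => hg ▸ star_mul_self_nonneg (g t)⟩

/-- Evaluation at a point, as a linear functional. -/
def eval (t : G) : EllInfty G →ₗ[ℂ] ℂ where
  toFun f := f t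
  map_add' _ _ := rfl
  map_smul' _ _ := rfl

theorem isUnitalPositive_eval (t : G) : IsUnitalPositive (eval t) := ⟨rfl, fun _ h => h t⟩

end EllInfty

/-! ### Algebras with a group action -/

/-- Ordered algebras on which `G` acts by unital positive maps. The action is not a `MulAction`,
because `C(X, ℂ)` already carries the pointwise action of any `G` acting on `ℂ`. -/
class GAlgebra (G : Type*) [Group G] (A : Type*) [Semiring A] [PartialOrder A] [Module ℂ A] where
  act : G →* Module.End ℂ A
  isUnitalPositive_act : ∀ s, IsUnitalPositive (act s)

open GAlgebra

instance EllInfty.instGAlgebra (G : Type u) [Group G] : GAlgebra G (EllInfty G) where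
  act :=
    { toFun := fun s =>
        { toFun := EllInfty.translate s
          map_add' := fun _ _ => rfl
          map_smul' := fun _ _ => rfl }
      map_one' := LinearMap.ext fun f => EllInfty.ext fun t => by
        change f (1⁻¹ * t) = f t
        rw [inv_one, one_mul]
      map_mul' := fun s t => LinearMap.ext fun f => EllInfty.ext fun r => by
        change f ((s * t)⁻¹ * r) = f (t⁻¹ * (s⁻¹ * r))
        rw [mul_inv_rev, mul_assoc] }
  isUnitalPositive_act s := ⟨rfl, fun _ hf t => hf (s⁻¹ * t)⟩

theorem EllInfty.act_apply {G : Type u} [Group G] (s : G) (f : EllInfty G) (t : G) :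
    act s f t = f (s⁻¹ * t) := rfl

section ContinuousFunctions

variable {G : Type u} [Group G] {X : Type v} [TopologicalSpace X] [CompactSpace X] [MulAction G X]
  [ContinuousConstSMul G X]

instance instGAlgebraContinuousMap : GAlgebra G C(X, ℂ) where
  act :=
    { toFun := fun s => GOperatorSystem.translate X s
      map_one' := by
        ext f x
        change f ((1 : G)⁻¹ • x) = f x
        rw [inv_one, one_smul]
      map_mul' := fun s t => by
        ext f x
        change f ((s * t)⁻¹ • x) = f (t⁻¹ • s⁻¹ • x)
        rw [mul_inv_rev, mul_smul] }
  isUnitalPositive_act s := isUnitalPositive_starAlgHom (GOperatorSystem.translate X s)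

theorem act_continuousMap_apply (s : G) (f : C(X, ℂ)) (x : X) : act s f x = f (s⁻¹ • x) := rfl

end ContinuousFunctions

section GMap

variable (G : Type*) [Group G] {A B C : Type*} [Semiring A] [PartialOrder A] [Module ℂ A]
  [Semiring B] [PartialOrder B] [Module ℂ B] [Semiring C] [PartialOrder C] [Module ℂ C]
  [GAlgebra G A] [GAlgebra G B] [GAlgebra G C]

/-- Unital positive `G`-equivariant maps. -/
structure IsGMap (φ : A →ₗ[ℂ] B) : Prop extends IsUnitalPositive φ where
  map_act : ∀ (s : G) (a : A), φ (act s a) = act s (φ a)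

variable {G}

namespace IsGMap

theorem id : IsGMap G (LinearMap.id : A →ₗ[ℂ] A) := ⟨.id, fun _ _ => rfl⟩

theorem comp {ψ : B →ₗ[ℂ] C} {φ : A →ₗ[ℂ] B} (hψ : IsGMap G ψ) (hφ : IsGMap G φ) :
    IsGMap G (ψ ∘ₗ φ) :=
  ⟨hψ.toIsUnitalPositive.comp hφ.toIsUnitalPositive, fun s a => by
    rw [LinearMap.comp_apply, hφ.map_act, hψ.map_act, LinearMap.comp_apply]⟩

end IsGMap

end GMap

theorem IsGMap.midpoint {G A B : Type*} [Group G] [CStarAlgebra A] [PartialOrder A]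
    [CStarAlgebra B] [PartialOrder B] [StarOrderedRing B]
    [GAlgebra G A] [GAlgebra G B] {φ ψ : A →ₗ[ℂ] B} (hφ : IsGMap G φ) (hψ : IsGMap G ψ) :
    IsGMap G ((1 / 2 : ℂ) • (φ + ψ)) where
  map_one := by
    rw [LinearMap.smul_apply, LinearMap.add_apply, hφ.map_one, hψ.map_one, ← two_smul ℂ, smul_smul]
    norm_num
  map_nonneg a ha :=
    smul_nonneg (by positivity) (add_nonneg (hφ.map_nonneg a ha) (hψ.map_nonneg a ha))
  map_act s a := by
    simp only [LinearMap.smul_apply, LinearMap.add_apply, hφ.map_act, hψ.map_act, map_add, map_smul]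

section Poisson

variable {G : Type u} [Group G] {V : Type*} [AddCommGroup V] [Module ℂ V]

/-- The `G`-equivariant map into `ℓ^∞(G)` whose composition with the evaluation at `1` is the
functional `σ`. -/
def poissonMap (ρ : G →* Module.End ℂ V) (σ : V →ₗ[ℂ] ℂ)
    (hσ : ∀ v, ∃ c, ∀ t, ‖σ (ρ t⁻¹ v)‖ ≤ c) : V →ₗ[ℂ] EllInfty G where
  toFun v := ⟨fun t => σ (ρ t⁻¹ v), memℓp_infty <| (hσ v).imp fun _ hc => by
    rintro _ ⟨t, rfl⟩
    exact hc t⟩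
  map_add' v w := EllInfty.ext fun t => (σ ∘ₗ ρ t⁻¹).map_add v w
  map_smul' c v := EllInfty.ext fun t => (σ ∘ₗ ρ t⁻¹).map_smul c v

variable {ρ : G →* Module.End ℂ V} {σ : V →ₗ[ℂ] ℂ} (hσ : ∀ v, ∃ c, ∀ t, ‖σ (ρ t⁻¹ v)‖ ≤ c)

theorem poissonMap_apply (v : V) (t : G) : poissonMap ρ σ hσ v t = σ (ρ t⁻¹ v) := rfl

theorem poissonMap_map (s : G) (v : V) :
    poissonMap ρ σ hσ (ρ s v) = act s (poissonMap ρ σ hσ v) :=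
  EllInfty.ext fun t => by
    rw [EllInfty.act_apply, poissonMap_apply, poissonMap_apply, ← Module.End.mul_apply, ← map_mul,
      mul_inv_rev, inv_inv]

theorem apply_eq_apply_one_of_equivariant {φ : V →ₗ[ℂ] EllInfty G}
    (hφ : ∀ s v, φ (ρ s v) = act s (φ v)) (v : V) (t : G) : φ v t = φ (ρ t⁻¹ v) 1 := by
  rw [hφ, EllInfty.act_apply, inv_inv, mul_one]

end Poisson

section OrbitHom

variable {G : Type u} [Group G] {X : Type v} [TopologicalSpace X] [CompactSpace X] [MulAction G X]

/-- Restriction of continuous functions to the orbit of `x`. -/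
def orbitHom (x : X) : C(X, ℂ) →⋆ₐ[ℂ] EllInfty G where
  toFun f := ⟨fun t => f (t • x), memℓp_infty ⟨‖f‖, by
    rintro _ ⟨t, rfl⟩
    exact f.norm_coe_le_norm _⟩⟩
  map_one' := rfl
  map_mul' _ _ := rfl
  map_zero' := rfl
  map_add' _ _ := rfl
  commutes' _ := rfl
  map_star' _ := rfl

theorem isGMap_orbitHom [ContinuousConstSMul G X] (x : X) :
    IsGMap G (orbitHom (G := G) x).toLinearMap where
  map_one := rfl
  map_nonneg _ h t := h (t • x)
  map_act s f := EllInfty.ext fun t => by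
    change f (s⁻¹ • t • x) = f ((s⁻¹ * t) • x)
    rw [mul_smul]

end OrbitHom

/-! ### State spaces -/

/-- The state space of `A`, with the weak* topology. -/
def StateSpace (A : Type*) [Semiring A] [PartialOrder A] [Module ℂ A] : Type _ :=
  {τ : A →ₗ[ℂ] ℂ // IsUnitalPositive τ}

namespace StateSpace

open Filter Topology

section Basic

variable {A B : Type*} [Semiring A] [PartialOrder A] [Module ℂ A] [Semiring B] [PartialOrder B]
  [Module ℂ B]

instance : FunLike (StateSpace A) A ℂ where
  coe τ := τ.1
  coe_injective _ _ h := Subtype.ext (DFunLike.coe_injective h)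

instance : LinearMapClass (StateSpace A) ℂ A ℂ where
  map_add τ := τ.1.map_add
  map_smulₛₗ τ := τ.1.map_smul

instance : TopologicalSpace (StateSpace A) := .induced (fun τ a => τ a) inferInstance

@[ext] theorem ext {τ τ' : StateSpace A} (h : ∀ a, τ a = τ' a) : τ = τ' := DFunLike.ext _ _ h

theorem apply_one (τ : StateSpace A) : τ 1 = 1 := τ.2.map_one

theorem apply_nonneg (τ : StateSpace A) {a : A} (ha : 0 ≤ a) : 0 ≤ τ a := τ.2.map_nonneg a ha

theorem isEmbedding_coe : IsEmbedding (fun (τ : StateSpace A) a => τ a) :=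
  ⟨⟨rfl⟩, fun _ _ h => DFunLike.coe_injective h⟩

theorem continuous_apply (a : A) : Continuous fun τ : StateSpace A => τ a :=
  (_root_.continuous_apply a).comp isEmbedding_coe.continuous

theorem continuous_of_forall {Y : Type*} [TopologicalSpace Y] {f : Y → StateSpace A}
    (h : ∀ a, Continuous fun y => f y a) : Continuous f :=
  isEmbedding_coe.continuous_iff.2 (continuous_pi h)

instance : T2Space (StateSpace A) := isEmbedding_coe.t2Space

/-- Precomposition with a unital positive map. -/
def comap {φ : A →ₗ[ℂ] B} (hφ : IsUnitalPositive φ) (τ : StateSpace B) : StateSpace A :=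
  ⟨τ.1 ∘ₗ φ, τ.2.comp hφ⟩

@[simp] theorem comap_apply {φ : A →ₗ[ℂ] B} (hφ : IsUnitalPositive φ) (τ : StateSpace B) (a : A) :
    τ.comap hφ a = τ (φ a) := rfl

theorem continuous_comap {φ : A →ₗ[ℂ] B} (hφ : IsUnitalPositive φ) : Continuous (comap hφ) :=
  continuous_of_forall fun a => continuous_apply (φ a)

variable {G : Type*} [Group G] [GAlgebra G A] [GAlgebra G B]

instance : MulAction G (StateSpace A) where
  smul s τ := τ.comap (isUnitalPositive_act s⁻¹)
  one_smul τ := ext fun a => by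
    change τ (act (1 : G)⁻¹ a) = τ a
    rw [inv_one, map_one, Module.End.one_apply]
  mul_smul s t τ := ext fun a => by
    change τ (act (s * t)⁻¹ a) = τ (act t⁻¹ (act s⁻¹ a))
    rw [mul_inv_rev, map_mul, Module.End.mul_apply]

theorem smul_apply (s : G) (τ : StateSpace A) (a : A) : (s • τ) a = τ (act s⁻¹ a) := rfl

instance : ContinuousConstSMul G (StateSpace A) :=
  ⟨fun s => continuous_comap (isUnitalPositive_act s⁻¹)⟩

theorem comap_smul {φ : A →ₗ[ℂ] B} (hφ : IsGMap G φ) (s : G) (τ : StateSpace B) :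
    (s • τ).comap hφ.toIsUnitalPositive = s • τ.comap hφ.toIsUnitalPositive :=
  ext fun a => by simp only [comap_apply, smul_apply, hφ.map_act]

end Basic

section CStarAlgebra

variable {A : Type*} [CStarAlgebra A] [PartialOrder A]

theorem isClosed_range_coe : IsClosed (Set.range fun (τ : StateSpace A) a => τ a) := by
  have hrange : (Set.range fun (τ : StateSpace A) a => τ a) =
      Set.range (fun (τ : A →ₗ[ℂ] ℂ) a => τ a) ∩
        ({f | f 1 = 1} ∩ ⋂ a ∈ Set.Ici (0 : A), {f | 0 ≤ f a}) := by
    ext f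
    constructor
    · rintro ⟨τ, rfl⟩
      exact ⟨⟨τ.1, rfl⟩, τ.2.map_one, Set.mem_iInter₂.2 τ.2.map_nonneg⟩
    · rintro ⟨⟨τ, rfl⟩, h1, hpos⟩
      exact ⟨⟨τ, h1, Set.mem_iInter₂.1 hpos⟩, rfl⟩
  rw [hrange]
  refine (LinearMap.isClosed_range_coe A ℂ (RingHom.id ℂ)).inter
    ((isClosed_eq (_root_.continuous_apply 1) continuous_const).inter
      (isClosed_biInter fun a _ => isClosed_Ici.preimage (_root_.continuous_apply a)))

variable [StarOrderedRing A]

theorem apply_star (τ : StateSpace A) (a : A) : τ (star a) = star (τ a) := τ.2.apply_star a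

theorem norm_apply_le (τ : StateSpace A) (a : A) : ‖τ a‖ ≤ ‖a‖ := τ.2.norm_apply_le_norm a

instance : CompactSpace (StateSpace A) := by
  have hcompact : IsCompact (Set.univ.pi fun a : A => Metric.closedBall (0 : ℂ) ‖a‖) :=
    isCompact_univ_pi fun a => isCompact_closedBall 0 ‖a‖
  refine ⟨isEmbedding_coe.isCompact_iff.2 ?_⟩
  rw [Set.image_univ]
  refine hcompact.of_isClosed_subset isClosed_range_coe ?_
  rintro _ ⟨τ, rfl⟩ a -
  simpa using! τ.norm_apply_le a

variable {G : Type u} [Group G] [GAlgebra G A]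

/-- The Poisson map of a state. -/
def poissonMap (τ : StateSpace A) : A →ₗ[ℂ] EllInfty G :=
  _root_.poissonMap act τ.1 fun a =>
    ⟨‖a‖, fun t => (τ.2.comp (isUnitalPositive_act t⁻¹)).norm_apply_le_norm a⟩

theorem isGMap_poissonMap (τ : StateSpace A) : IsGMap G (poissonMap (G := G) τ) where
  map_one := EllInfty.ext fun t => (t • τ).apply_one
  map_nonneg _ ha t := (t • τ).apply_nonneg ha
  map_act := poissonMap_map _

end CStarAlgebra

end StateSpace

/-- Evaluation at `x`, as a state. -/
def pointState {X : Type*} [TopologicalSpace X] (x : X) : StateSpace C(X, ℂ) :=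
  ⟨(ContinuousMap.evalCLM ℂ x).toLinearMap, rfl, fun _ h => h x⟩

section PointState

variable {X : Type*} [TopologicalSpace X]

@[simp] theorem pointState_apply (x : X) (f : C(X, ℂ)) : pointState x f = f x := rfl

theorem continuous_pointState : Continuous (pointState : X → StateSpace C(X, ℂ)) :=
  StateSpace.continuous_of_forall fun f => f.continuous

variable [CompactSpace X]

theorem pointState_smul {G : Type*} [Group G] [MulAction G X] [ContinuousConstSMul G X] (s : G)
    (x : X) : pointState (s • x) = s • pointState x :=
  StateSpace.ext fun f => by
    rw [StateSpace.smul_apply, pointState_apply, pointState_apply, act_continuousMap_apply,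
      inv_inv]

variable [T2Space X]

theorem pointState_injective : Function.Injective (pointState : X → StateSpace C(X, ℂ)) :=
  fun _ _ h => (WeakDual.CharacterSpace.continuousMapEval_bijective (X := X) (𝕜 := ℂ)).1 <|
    WeakDual.CharacterSpace.ext fun f => DFunLike.congr_fun h f

theorem isClosedEmbedding_pointState :
    Topology.IsClosedEmbedding (pointState : X → StateSpace C(X, ℂ)) :=
  continuous_pointState.isClosedEmbedding pointState_injective

end PointState

/-! ### Strong proximality in terms of states -/

section Riesz

open MeasureTheory Filter Topology

/-- The inclusion of the real continuous functions into the complex ones. -/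
def ofRealContinuousMap (X : Type*) [TopologicalSpace X] : C(X, ℝ) →L[ℝ] C(X, ℂ) :=
  Complex.ofRealCLM.compLeftContinuous ℝ X

variable {X : Type*} [TopologicalSpace X]

@[simp] theorem ofRealContinuousMap_apply (f : C(X, ℝ)) (x : X) :
    ofRealContinuousMap X f x = f x := rfl

theorem ofRealContinuousMap_nonneg {f : C(X, ℝ)} (hf : 0 ≤ f) : 0 ≤ ofRealContinuousMap X f :=
  fun x => Complex.zero_le_real.2 (hf x)

theorem isSelfAdjoint_ofRealContinuousMap (f : C(X, ℝ)) :
    IsSelfAdjoint (ofRealContinuousMap X f) :=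
  ContinuousMap.ext fun x => Complex.conj_ofReal (f x)

theorem exists_eq_ofReal_add_I_smul_ofReal (f : C(X, ℂ)) :
    ∃ g h : C(X, ℝ), f = ofRealContinuousMap X g + Complex.I • ofRealContinuousMap X h :=
  ⟨Complex.reCLM.compLeftContinuous ℝ X f, Complex.imCLM.compLeftContinuous ℝ X f,
    ContinuousMap.ext fun x => by
      simp [mul_comm Complex.I, Complex.re_add_im]⟩

theorem StateSpace.ext_ofReal {τ τ' : StateSpace C(X, ℂ)}
    (h : ∀ f : C(X, ℝ), τ (ofRealContinuousMap X f) = τ' (ofRealContinuousMap X f)) : τ = τ' := by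
  refine StateSpace.ext fun f => ?_
  obtain ⟨g, k, rfl⟩ := exists_eq_ofReal_add_I_smul_ofReal f
  simp only [map_add, map_smul, h]

theorem StateSpace.tendsto_nhds_iff {A ι : Type*} [Semiring A] [PartialOrder A] [Module ℂ A]
    {F : Filter ι} {τs : ι → StateSpace A} {τ : StateSpace A} :
    Tendsto τs F (𝓝 τ) ↔ ∀ a, Tendsto (fun i => τs i a) F (𝓝 (τ a)) :=
  isEmbedding_coe.tendsto_nhds_iff.trans tendsto_pi_nhds

variable [CompactSpace X] [MeasurableSpace X]

section StateOfMeasure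

variable [OpensMeasurableSpace X]

theorem integrable_continuousMap {E : Type*} [NormedAddCommGroup E] (μ : Measure X)
    [IsFiniteMeasureOnCompacts μ] (f : C(X, E)) : Integrable f μ :=
  f.continuous.integrable_of_hasCompactSupport (HasCompactSupport.of_compactSpace _)

/-- Integration against a probability measure, as a state. -/
def stateOfMeasure (μ : ProbabilityMeasure X) : StateSpace C(X, ℂ) where
  val :=
    { toFun := fun f => ∫ x, f x ∂(μ : Measure X)
      map_add' := fun f g =>
        integral_add (integrable_continuousMap _ f) (integrable_continuousMap _ g)
      map_smul' := fun c f => integral_smul c _ }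
  property := ⟨by simp, fun _ hf => integral_nonneg hf⟩

theorem stateOfMeasure_apply (μ : ProbabilityMeasure X) (f : C(X, ℂ)) :
    stateOfMeasure μ f = ∫ x, f x ∂(μ : Measure X) := rfl

theorem stateOfMeasure_diracProba (x : X) : stateOfMeasure (diracProba x) = pointState x :=
  StateSpace.ext fun f => integral_dirac' _ _ f.continuous.stronglyMeasurable

theorem tendsto_stateOfMeasure_iff {ι : Type*} {F : Filter ι} {μs : ι → ProbabilityMeasure X}
    {μ : ProbabilityMeasure X} :
    Tendsto (fun i => stateOfMeasure (μs i)) F (𝓝 (stateOfMeasure μ)) ↔ Tendsto μs F (𝓝 μ) := by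
  rw [StateSpace.tendsto_nhds_iff, ProbabilityMeasure.tendsto_iff_forall_integral_rclike_tendsto ℂ]
  exact ⟨fun h f => h f.toContinuousMap, fun h f => h (BoundedContinuousFunction.mkOfCompact f)⟩

theorem isInducing_stateOfMeasure :
    IsInducing (stateOfMeasure : ProbabilityMeasure X → StateSpace C(X, ℂ)) :=
  isInducing_iff_nhds.2 fun _ => le_antisymm
    (map_le_iff_le_comap.1 (tendsto_stateOfMeasure_iff.2 tendsto_id))
    (tendsto_stateOfMeasure_iff.1 tendsto_comap)

end StateOfMeasure

variable [BorelSpace X]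

theorem stateOfMeasure_map_smul {G : Type*} [Group G] [MulAction G X] [ContinuousConstSMul G X]
    (s : G) (μ : ProbabilityMeasure X) :
    stateOfMeasure (μ.map (f := fun y => s • y) (continuous_const_smul s).measurable.aemeasurable) =
      s • stateOfMeasure μ :=
  StateSpace.ext fun f => by
    rw [StateSpace.smul_apply, stateOfMeasure_apply, stateOfMeasure_apply,
      ProbabilityMeasure.toMeasure_map,
      integral_map (continuous_const_smul s).measurable.aemeasurable
        f.continuous.aestronglyMeasurable]
    simp only [act_continuousMap_apply, inv_inv]

theorem exists_stateOfMeasure_eq [T2Space X] (τ : StateSpace C(X, ℂ)) :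
    ∃ μ : ProbabilityMeasure X, (μ : Measure X).Regular ∧ stateOfMeasure μ = τ := by
  let Λ : CompactlySupportedContinuousMap X ℝ →ₚ[ℝ] ℝ := .mk₀
    { toFun := fun g => (τ (ofRealContinuousMap X g.toContinuousMap)).re
      map_add' := fun g h =>
        congrArg Complex.re (map_add (τ.1.restrictScalars ℝ ∘ₗ (ofRealContinuousMap X).toLinearMap)
          g.toContinuousMap h.toContinuousMap)
      map_smul' := fun c g =>
        congrArg Complex.re (map_smul (τ.1.restrictScalars ℝ ∘ₗ (ofRealContinuousMap X).toLinearMap)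
          c g.toContinuousMap) |>.trans (Complex.smul_re c _) }
    fun g hg => (Complex.nonneg_iff.1 (τ.apply_nonneg (ofRealContinuousMap_nonneg hg))).1
  have hΛ (f : C(X, ℝ)) :
      ∫ x, f x ∂(RealRMK.rieszMeasure Λ) = (τ (ofRealContinuousMap X f)).re :=
    RealRMK.integral_rieszMeasure Λ ⟨f, HasCompactSupport.of_compactSpace _⟩
  have hone : ofRealContinuousMap X 1 = 1 := ContinuousMap.ext fun _ => Complex.ofReal_one
  have hprob : IsProbabilityMeasure (RealRMK.rieszMeasure Λ) := ⟨by
    have := hΛ 1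
    rw [hone, τ.apply_one] at this
    simpa [Measure.real, ENNReal.toReal_eq_one_iff] using this⟩
  refine ⟨⟨RealRMK.rieszMeasure Λ, hprob⟩, inferInstanceAs (RealRMK.rieszMeasure Λ).Regular,
    StateSpace.ext_ofReal fun f => ?_⟩
  have him := τ.2.isState.im_apply_eq_zero isOperatorSystem_id (isSelfAdjoint_ofRealContinuousMap f)
  exact (integral_ofReal.trans (congrArg _ (hΛ f))).trans (Complex.ext rfl him.symm)

end Riesz

section Proximality

variable (G : Type*) [Group G] (X : Type*) [TopologicalSpace X] [CompactSpace X] [MulAction G X]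
  [ContinuousConstSMul G X]

/-- Strong proximality in terms of states: the weak* closure of the orbit of every state on `C(X)`
contains an evaluation at a point. -/
def IsStateProximal : Prop :=
  ∀ τ : StateSpace C(X, ℂ), ∃ x : X, pointState x ∈ closure (MulAction.orbit G τ)

end Proximality

theorem isStronglyProximal_iff {G : Type u} [Group G] {X : Type v} [TopologicalSpace X]
    [CompactSpace X] [MulAction G X] [ContinuousConstSMul G X] [T2Space X] :
    IsStronglyProximal G X ↔ IsStateProximal G X := by
  let _ : MeasurableSpace X := borel X
  have : BorelSpace X := ⟨rfl⟩
  have hiff (μ : MeasureTheory.ProbabilityMeasure X) (x : X) :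
      MeasureTheory.diracProba x ∈ closure (Set.range fun s : G =>
          μ.map (f := fun y => s • y) (continuous_const_smul s).measurable.aemeasurable) ↔
        pointState x ∈ closure (MulAction.orbit G (stateOfMeasure μ)) := by
    rw [isInducing_stateOfMeasure.closure_eq_preimage_closure_image, Set.mem_preimage,
      stateOfMeasure_diracProba, ← Set.range_comp]
    simp only [Function.comp_def, stateOfMeasure_map_smul]
    rfl
  constructor
  · intro h τ
    obtain ⟨μ, hreg, rfl⟩ := exists_stateOfMeasure_eq τ
    exact (h μ hreg).imp fun x => (hiff μ x).1
  · exact fun h μ _ => (h (stateOfMeasure μ)).imp fun x => (hiff μ x).2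

/-! ### Extreme states and barycenters -/

namespace StateSpace

open Topology

section ExtremePoints

variable {A : Type*} [CStarAlgebra A] [PartialOrder A]

/-- The states that are nonnegative on `P`. -/
def nonnegOn (P : Set A) : Set (StateSpace A) := {τ | ∀ a ∈ P, 0 ≤ τ a}

/-- `τ` is an extreme point of `K`, tested on midpoints. -/
def IsMidpointExtreme (K : Set (StateSpace A)) (τ : StateSpace A) : Prop :=
  ∀ σ ∈ K, ∀ σ' ∈ K, (∀ a, σ a + σ' a = 2 * τ a) → σ = τ

theorem isClosed_nonnegOn (P : Set A) : IsClosed (nonnegOn P) := by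
  simp only [nonnegOn, Set.ofPred_forall]
  exact isClosed_biInter fun a _ => isClosed_Ici.preimage (continuous_apply a)

theorem exists_isMidpointExtreme [StarOrderedRing A] {K : Set (StateSpace A)} (hK : IsClosed K)
    (hne : K.Nonempty) : ∃ τ ∈ K, IsMidpointExtreme K τ := by
  obtain ⟨_, ⟨⟨τ, hτ, rfl⟩, hext⟩⟩ :=
    (hK.isCompact.image isEmbedding_coe.continuous).extremePoints_nonempty (hne.image _)
  refine ⟨τ, hτ, fun σ hσ σ' hσ' hmid => isEmbedding_coe.injective <|
    hext ⟨σ, hσ, rfl⟩ ⟨σ', hσ', rfl⟩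
      ⟨1 / 2, 1 / 2, by norm_num, by norm_num, by norm_num, funext fun a => ?_⟩⟩
  simp only [Pi.add_apply, Pi.smul_apply, Complex.real_smul, ← mul_add, hmid]
  push_cast
  ring

end ExtremePoints

section Barycenter

variable {A : Type*} [CStarAlgebra A] [PartialOrder A] {Y : Type*} [TopologicalSpace Y]

/-- The function on `Y` attached to an element of `A` by a continuous family of states. -/
def toFunctions (q : C(Y, StateSpace A)) : A →ₗ[ℂ] C(Y, ℂ) where
  toFun a := ⟨fun y => q y a, (continuous_apply a).comp q.continuous⟩
  map_add' a b := ContinuousMap.ext fun y => map_add (q y) a b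
  map_smul' c a := ContinuousMap.ext fun y => map_smul (q y) c a

@[simp] theorem toFunctions_apply (q : C(Y, StateSpace A)) (a : A) (y : Y) :
    toFunctions q a y = q y a := rfl

theorem isUnitalPositive_toFunctions (q : C(Y, StateSpace A)) :
    IsUnitalPositive (toFunctions q) :=
  ⟨ContinuousMap.ext fun y => (q y).apply_one, fun _ ha y => (q y).apply_nonneg ha⟩

/-- The average of a continuous family of states over a state on its parameter space. -/
def barycenter (q : C(Y, StateSpace A)) : StateSpace C(Y, ℂ) → StateSpace A :=
  comap (isUnitalPositive_toFunctions q)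

@[simp] theorem barycenter_apply (q : C(Y, StateSpace A)) (τ : StateSpace C(Y, ℂ)) (a : A) :
    barycenter q τ a = τ (toFunctions q a) := rfl

theorem continuous_barycenter (q : C(Y, StateSpace A)) : Continuous (barycenter q) :=
  continuous_comap _

theorem barycenter_mem_nonnegOn {q : C(Y, StateSpace A)} {P : Set A} (hq : ∀ y, q y ∈ nonnegOn P)
    (τ : StateSpace C(Y, ℂ)) : barycenter q τ ∈ nonnegOn P :=
  fun a ha => τ.apply_nonneg fun y => hq y a ha

theorem isGMap_toFunctions {G : Type*} [Group G] [GAlgebra G A] [CompactSpace Y] [MulAction G Y]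
    [ContinuousConstSMul G Y] {q : C(Y, StateSpace A)} (hq : ∀ (s : G) y, q (s • y) = s • q y) :
    IsGMap G (toFunctions q) :=
  ⟨isUnitalPositive_toFunctions q, fun s a => ContinuousMap.ext fun y => by
    rw [act_continuousMap_apply, toFunctions_apply, toFunctions_apply, hq, smul_apply, inv_inv]⟩

theorem barycenter_smul {G : Type*} [Group G] [GAlgebra G A] [CompactSpace Y] [MulAction G Y]
    [ContinuousConstSMul G Y] {q : C(Y, StateSpace A)} (hq : ∀ (s : G) y, q (s • y) = s • q y)
    (s : G) (τ : StateSpace C(Y, ℂ)) : barycenter q (s • τ) = s • barycenter q τ :=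
  comap_smul (isGMap_toFunctions hq) s τ

variable [CompactSpace Y]

theorem isState_toFunctions {q : C(Y, StateSpace A)} {σ : StateSpace A}
    (hσ : ∀ a, (∀ y, 0 ≤ q y a) → 0 ≤ σ a) : IsState (toFunctions q) σ.1 where
  map_eq_one a ha := by
    have hzero : ∀ y, q y (a - 1) = 0 := fun y => by
      rw [map_sub, (q y).apply_one, sub_eq_zero]
      exact DFunLike.congr_fun ha y
    have hle := hσ (a - 1) fun y => (hzero y).ge
    have hge := hσ (-(a - 1)) fun y => by rw [map_neg, hzero, neg_zero]
    rw [map_neg, neg_nonneg] at hge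
    have heq : σ (a - 1) = 0 := le_antisymm hge hle
    rwa [map_sub, σ.apply_one, sub_eq_zero] at heq
  map_nonneg := hσ

variable [StarOrderedRing A]

theorem isOperatorSystem_toFunctions (q : C(Y, StateSpace A)) :
    IsOperatorSystem (toFunctions q) where
  exists_map_eq_one := ⟨1, (isUnitalPositive_toFunctions q).map_one⟩
  exists_map_eq_star a := ⟨star a, (isUnitalPositive_toFunctions q).map_star a⟩

theorem exists_barycenter_eq {q : C(Y, StateSpace A)} {σ : StateSpace A}
    (hσ : ∀ a, (∀ y, 0 ≤ q y a) → 0 ≤ σ a) : ∃ τ, barycenter q τ = σ := by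
  obtain ⟨τ, hτ, hτσ⟩ := exists_isUnitalPositive_comp_eq
    (isUnitalPositive_toFunctions q).map_one σ.apply_one
    ((isState_toFunctions hσ).norm_apply_le (isOperatorSystem_toFunctions q))
  exact ⟨⟨τ, hτ⟩, Subtype.ext hτσ⟩

end Barycenter

section MultiplicativeDomain

variable {A : Type*} [CommCStarAlgebra A] [PartialOrder A] [StarOrderedRing A]

/-- The multiplicative domain of a state. -/
def multiplicativeDomain (τ : StateSpace A) : StarSubalgebra ℂ A where
  carrier := {b | ∀ a, τ (a * b) = τ a * τ b}
  mul_mem' {b c} hb hc a := by rw [← mul_assoc, hc, hb, hc, mul_assoc]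
  one_mem' a := by rw [mul_one, τ.apply_one, mul_one]
  add_mem' {b c} hb hc a := by rw [mul_add, map_add, hb, hc, map_add, mul_add]
  zero_mem' a := by rw [mul_zero, map_zero, mul_zero]
  algebraMap_mem' c a := by
    rw [Algebra.algebraMap_eq_smul_one, mul_smul_comm, map_smul, map_smul, mul_one, τ.apply_one,
      smul_eq_mul, smul_eq_mul, mul_one, mul_comm]
  star_mem' {b} hb a := by
    have := congrArg star (hb (star a))
    rwa [← apply_star, star_mul', star_star, star_mul', ← apply_star, ← apply_star,
      star_star] at this

theorem mem_multiplicativeDomain {τ : StateSpace A} {b : A} :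
    b ∈ multiplicativeDomain τ ↔ ∀ a, τ (a * b) = τ a * τ b := Iff.rfl

protected theorem continuous (τ : StateSpace A) : Continuous τ :=
  (τ.1.mkContinuous 1 fun a => by simpa using! τ.norm_apply_le a).continuous

theorem isClosed_multiplicativeDomain (τ : StateSpace A) :
    IsClosed (multiplicativeDomain τ : Set A) := by
  have : (multiplicativeDomain τ : Set A) = ⋂ a, {b | τ (a * b) = τ a * τ b} :=
    Set.ext fun b => by simp [mem_multiplicativeDomain]
  rw [this]
  exact isClosed_iInter fun a => isClosed_eq (τ.continuous.comp (continuous_const_mul a))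
    (continuous_const.mul τ.continuous)

variable {Y : Type*} [TopologicalSpace Y] [CompactSpace Y] [T2Space Y]

theorem exists_eq_pointState_of_map_mul {τ : StateSpace C(Y, ℂ)}
    (hτ : ∀ f g, τ (f * g) = τ f * τ g) : ∃ y, τ = pointState y := by
  obtain ⟨y, hy⟩ := (WeakDual.CharacterSpace.continuousMapEval_bijective (X := Y) (𝕜 := ℂ)).2
    (WeakDual.CharacterSpace.equivAlgHom.symm (AlgHom.ofLinearMap τ.1 τ.apply_one hτ))
  exact ⟨y, ext fun f => (DFunLike.congr_fun hy f).symm⟩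

theorem exists_eq_pointState_of_separatesPoints {τ : StateSpace C(Y, ℂ)}
    (hτ : (multiplicativeDomain τ).SeparatesPoints) : ∃ y, τ = pointState y := by
  have htop : multiplicativeDomain τ = ⊤ := by
    rw [eq_top_iff,
      ← ContinuousMap.starSubalgebra_topologicalClosure_eq_top_of_separatesPoints _ hτ]
    exact StarSubalgebra.topologicalClosure_minimal le_rfl (isClosed_multiplicativeDomain τ)
  exact exists_eq_pointState_of_map_mul fun f g =>
    mem_multiplicativeDomain.1 (htop ▸ StarSubalgebra.mem_top) f

end MultiplicativeDomain

section Perturbation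

variable {A : Type*} [CommCStarAlgebra A] [PartialOrder A] [StarOrderedRing A]

/-- The state with density `1 + h` relative to `τ`. -/
def perturb (τ : StateSpace A) (h : A) (hh : 0 ≤ 1 + h) (hτh : τ h = 0) : StateSpace A :=
  ⟨τ.1 ∘ₗ LinearMap.mulLeft ℂ (1 + h), by
    change τ ((1 + h) * 1) = 1
    rw [mul_one, map_add, hτh, τ.apply_one, add_zero],
    fun a ha => τ.apply_nonneg (mul_nonneg hh ha)⟩

theorem perturb_apply {τ : StateSpace A} {h : A} (hh : 0 ≤ 1 + h) (hτh : τ h = 0) (a : A) :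
    τ.perturb h hh hτh a = τ a + τ (h * a) := by
  change τ ((1 + h) * a) = _
  rw [add_mul, one_mul, map_add]

theorem exists_smul_perturbation {h : A} (hh : IsSelfAdjoint h) :
    ∃ ε : ℂ, ε ≠ 0 ∧ 0 ≤ 1 + ε • h ∧ 0 ≤ 1 + -(ε • h) := by
  have hc : (0 : ℂ) < ‖h‖ + 1 := by exact_mod_cast (by positivity : (0 : ℝ) < ‖h‖ + 1)
  have hpos {k : A} (hk : 0 ≤ algebraMap ℝ A ‖h‖ + k) : 0 ≤ 1 + (‖h‖ + 1 : ℂ)⁻¹ • k := by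
    have hone : algebraMap ℝ A ‖h‖ + 1 = (‖h‖ + 1 : ℂ) • 1 := by
      rw [add_smul, one_smul, IsScalarTower.algebraMap_apply ℝ ℂ A,
        Algebra.algebraMap_eq_smul_one (A := A), Complex.coe_algebraMap]
    have hsum : 1 + (‖h‖ + 1 : ℂ)⁻¹ • k = (‖h‖ + 1 : ℂ)⁻¹ • (algebraMap ℝ A ‖h‖ + k + 1) := by
      rw [add_right_comm, hone, smul_add, inv_smul_smul₀ hc.ne']
    exact hsum ▸ smul_nonneg (inv_nonneg.2 hc.le) (add_nonneg hk zero_le_one)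
  refine ⟨(‖h‖ + 1 : ℂ)⁻¹, inv_ne_zero hc.ne', hpos ?_, ?_⟩
  · exact neg_le_iff_add_nonneg'.1 hh.neg_algebraMap_norm_le_self
  · rw [← smul_neg]
    exact hpos (by simpa [← sub_eq_add_neg] using hh.le_algebraMap_norm_self)

end Perturbation

section ExtremeBarycenter

variable {A : Type*} [CStarAlgebra A] [PartialOrder A] {P : Set A} {σ : StateSpace A}
  {Y : Type*} [TopologicalSpace Y] [CompactSpace Y] {q : C(Y, StateSpace A)}
  {τ : StateSpace C(Y, ℂ)}

/- A density `1 ± h` would otherwise move the barycenter to two states with midpoint `σ`. -/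
theorem apply_mul_toFunctions_eq_zero (hq : ∀ y, q y ∈ nonnegOn P)
    (hσ : IsMidpointExtreme (nonnegOn P) σ) (hτ : barycenter q τ = σ) {h : C(Y, ℂ)}
    (hh : IsSelfAdjoint h) (hτh : τ h = 0) (a : A) : τ (h * toFunctions q a) = 0 := by
  obtain ⟨ε, hε, hpos, hneg⟩ := exists_smul_perturbation hh
  have hτε : τ (ε • h) = 0 := by rw [map_smul, hτh, smul_zero]
  have heq := hσ _ (barycenter_mem_nonnegOn hq (τ.perturb _ hpos hτε)) _
    (barycenter_mem_nonnegOn hq (τ.perturb _ hneg (by rw [map_neg, hτε, neg_zero])))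
    fun b => by
      simp only [barycenter_apply, perturb_apply, ← hτ, neg_mul, map_neg]
      ring
  have := DFunLike.congr_fun heq a
  rw [← hτ, barycenter_apply, perturb_apply, barycenter_apply, add_eq_left, smul_mul_assoc,
    map_smul] at this
  exact (smul_eq_zero.1 this).resolve_left hε

theorem toFunctions_mem_multiplicativeDomain (hq : ∀ y, q y ∈ nonnegOn P)
    (hσ : IsMidpointExtreme (nonnegOn P) σ) (hτ : barycenter q τ = σ) (a : A) :
    toFunctions q a ∈ multiplicativeDomain τ := by
  have hreal : ∀ f : C(Y, ℂ), IsSelfAdjoint f →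
      τ (f * toFunctions q a) = τ f * τ (toFunctions q a) := fun f hf => by
    have hsa : IsSelfAdjoint (τ f) := (τ.apply_star f).symm.trans (congrArg τ hf)
    have := apply_mul_toFunctions_eq_zero hq hσ hτ (h := f - τ f • 1)
      (hf.sub (hsa.smul (.one _))) (by simp [τ.apply_one]) a
    rwa [sub_mul, smul_mul_assoc, one_mul, map_sub, map_smul, sub_eq_zero] at this
  refine mem_multiplicativeDomain.2 fun f => ?_
  rw [← realPart_add_I_smul_imaginaryPart f, add_mul, map_add, smul_mul_assoc, map_smul,
    hreal _ (realPart f).2, hreal _ (imaginaryPart f).2, map_add, map_smul, add_mul,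
    smul_mul_assoc]

theorem exists_eq_pointState_of_barycenter_eq (hinj : Function.Injective q)
    (hq : ∀ y, q y ∈ nonnegOn P) (hσ : IsMidpointExtreme (nonnegOn P) σ)
    (hτ : barycenter q τ = σ) : ∃ y, q y = σ ∧ τ = pointState y := by
  have : T2Space Y := .of_injective_continuous hinj q.continuous
  obtain ⟨y, rfl⟩ := exists_eq_pointState_of_separatesPoints (τ := τ) fun y y' hne => by
    obtain ⟨a, ha⟩ := not_forall.1 fun h => hne (hinj (ext h))
    exact ⟨_, ⟨_, toFunctions_mem_multiplicativeDomain hq hσ hτ a, rfl⟩, ha⟩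
  exact ⟨y, hτ, rfl⟩

variable [StarOrderedRing A]

/- Milman's converse of the Krein–Milman theorem. -/
theorem mem_of_isMidpointExtreme {D : Set (StateSpace A)} (hD : IsClosed D) (hDP : D ⊆ nonnegOn P)
    (hσ : IsMidpointExtreme (nonnegOn P) σ) (hσD : σ ∈ nonnegOn {a | ∀ τ ∈ D, 0 ≤ τ a}) :
    σ ∈ D := by
  have := isCompact_iff_compactSpace.1 hD.isCompact
  obtain ⟨τ, hτ⟩ := exists_barycenter_eq (q := ⟨_, continuous_subtype_val⟩) (σ := σ)
    fun a ha => hσD a fun τ hτ => ha ⟨τ, hτ⟩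
  obtain ⟨y, rfl, -⟩ :=
    exists_eq_pointState_of_barycenter_eq Subtype.val_injective (fun y => hDP y.2) hσ hτ
  exact y.2

end ExtremeBarycenter

theorem isMidpointExtreme_pointState {Y : Type*} [TopologicalSpace Y] [CompactSpace Y] (y : Y) :
    IsMidpointExtreme (nonnegOn ∅) (pointState y) := fun σ _ σ' _ hmid => ext fun f => by
  set g := f - f y • (1 : C(Y, ℂ)) with hg
  have hgy : (star g * g) y = 0 := by simp [hg]
  have hpos : (0 : C(Y, ℂ)) ≤ star g * g := star_mul_self_nonneg g
  have hsum : σ (star g * g) + σ' (star g * g) = 0 := by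
    rw [hmid, pointState_apply, hgy, mul_zero]
  have hzero : σ (star g * g) = 0 := le_antisymm
    (hsum ▸ le_add_of_nonneg_right (σ'.apply_nonneg hpos)) (σ.apply_nonneg hpos)
  have hσg : star (σ g) * σ g ≤ 0 := hzero ▸ σ.2.star_apply_mul_apply_le g
  have : σ g = 0 := CStarRing.star_mul_self_eq_zero_iff _ |>.1 <|
    le_antisymm hσg (star_mul_self_nonneg _)
  rwa [hg, map_sub, map_smul, σ.apply_one, smul_eq_mul, mul_one, sub_eq_zero] at this

end StateSpace

/-! ### A boundary in the state space -/

section OrbitClosure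

open MulAction

variable {G X Y : Type*} [Group G] [TopologicalSpace X] [MulAction G X] [TopologicalSpace Y]
  [MulAction G Y]

theorem image_closure_orbit [CompactSpace X] [T2Space Y] {f : X → Y} (hf : Continuous f)
    (hsmul : ∀ (s : G) x, f (s • x) = s • f x) (x : X) :
    f '' closure (orbit G x) = closure (orbit G (f x)) := by
  rw [image_closure_of_isCompact isClosed_closure.isCompact hf.continuousOn, orbit, orbit,
    ← Set.range_comp]
  simp only [Function.comp_def, hsmul]

theorem closure_orbit_subset {K : Set X} (hK : IsClosed K) (hinv : ∀ (s : G), ∀ x ∈ K, s • x ∈ K)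
    {x : X} (hx : x ∈ K) : closure (orbit G x) ⊆ K :=
  closure_minimal (Set.range_subset_iff.2 fun s => hinv s x hx) hK

variable [ContinuousConstSMul G X]

theorem smul_mem_closure_orbit (s : G) {x y : X} (hy : y ∈ closure (orbit G x)) :
    s • y ∈ closure (orbit G x) :=
  smul_closure_orbit_subset s x (Set.smul_mem_smul_set hy)

/-- The closure of the orbit of `x`, as a `G`-space. -/
def orbitClosure (G : Type*) [Group G] [MulAction G X] [ContinuousConstSMul G X] (x : X) :
    SubMulAction G X where
  carrier := closure (orbit G x)
  smul_mem' s _ := smul_mem_closure_orbit s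

variable {x : X}

instance : Nonempty (orbitClosure G x) := ⟨⟨x, subset_closure (mem_orbit_self x)⟩⟩

instance [CompactSpace X] : CompactSpace (orbitClosure G x) :=
  isCompact_iff_compactSpace.1 isClosed_closure.isCompact

instance : ContinuousConstSMul G (orbitClosure G x) :=
  ⟨fun s => ((continuous_const_smul s).comp continuous_subtype_val).subtype_mk _⟩

theorem isMinimal_orbitClosure (hx : ∀ y ∈ orbitClosure G x, x ∈ closure (orbit G y)) :
    IsMinimal G (orbitClosure G x) where
  dense_orbit y z := by
    rw [closure_subtype, SubMulAction.val_image_orbit]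
    exact closure_orbit_subset isClosed_closure (fun s _ => smul_mem_closure_orbit s) (hx y y.2) z.2

end OrbitClosure

namespace StateSpace

open MulAction

variable {G : Type*} [Group G] {A : Type*} [CStarAlgebra A] [PartialOrder A] [GAlgebra G A]
  {P : Set A}

theorem smul_mem_nonnegOn (hP : ∀ (s : G), ∀ a ∈ P, act s a ∈ P) (s : G) {τ : StateSpace A}
    (hτ : τ ∈ nonnegOn P) : s • τ ∈ nonnegOn P :=
  fun a ha => hτ _ (hP s⁻¹ a ha)

theorem closure_orbit_subset_nonnegOn (hP : ∀ (s : G), ∀ a ∈ P, act s a ∈ P) {τ : StateSpace A}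
    (hτ : τ ∈ nonnegOn P) : closure (orbit G τ) ⊆ nonnegOn P :=
  closure_orbit_subset (isClosed_nonnegOn P) (fun s _ => smul_mem_nonnegOn hP s) hτ

theorem isMinimal_orbitClosure_of_mem_nonnegOn {σ : StateSpace A}
    (hinv : ∀ (s : G), ∀ a ∈ P, act s a ∈ P) (hσ : σ ∈ nonnegOn P)
    (hmem : ∀ τ ∈ nonnegOn P, σ ∈ closure (orbit G τ)) : IsMinimal G (orbitClosure G σ) :=
  isMinimal_orbitClosure fun τ hτ => hmem τ (closure_orbit_subset_nonnegOn hinv hσ hτ)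

variable [StarOrderedRing A]

theorem nonempty_nonnegOn_sUnion [Nonempty (StateSpace A)] {c : Set (Set A)}
    (hchain : IsChain (· ⊆ ·) c) (hne : ∀ P ∈ c, (nonnegOn P).Nonempty) :
    (nonnegOn (⋃₀ c)).Nonempty := by
  rcases c.eq_empty_or_nonempty with rfl | hc
  · simp [nonnegOn]
  have := hc.to_subtype
  have hanti {P Q : Set A} (h : P ⊆ Q) : nonnegOn Q ⊆ nonnegOn P := fun _ hτ a ha => hτ a (h ha)
  refine (IsCompact.nonempty_iInter_of_directed_nonempty_isCompact_isClosed
    (fun P : c => nonnegOn P.1) (fun P Q => ?_) (fun P => hne P P.2)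
    (fun P => (isClosed_nonnegOn P.1).isCompact) fun P => isClosed_nonnegOn P.1).mono ?_
  · rcases hchain.total P.2 Q.2 with h | h
    · exact ⟨Q, hanti h, subset_rfl⟩
    · exact ⟨P, subset_rfl, hanti h⟩
  · rintro τ hτ a ⟨P, hP, ha⟩
    exact Set.mem_iInter.1 hτ ⟨P, hP⟩ a ha

variable (G A) in
theorem exists_maximal_nonnegOn [Nonempty (StateSpace A)] : ∃ P, Maximal
    (fun P : Set A => (∀ (s : G), ∀ a ∈ P, act s a ∈ P) ∧ (nonnegOn P).Nonempty) P :=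
  zorn_subset _ fun c hc hchain => ⟨⋃₀ c, ⟨fun s _ ⟨P, hP, ha⟩ => ⟨P, hP, (hc hP).1 s _ ha⟩,
    nonempty_nonnegOn_sUnion hchain fun _ hP => (hc hP).2⟩, fun _ => Set.subset_sUnion_of_mem⟩

variable (G A) in
/- The states nonnegative on a maximal `P` form a minimal closed convex invariant set, so an extreme
state of it lies in the closed convex hull of every orbit, and hence in the orbit closure. -/
theorem exists_isMidpointExtreme_mem_closure_orbit [Nonempty (StateSpace A)] :
    ∃ (P : Set A) (σ : StateSpace A), (∀ (s : G), ∀ a ∈ P, act s a ∈ P) ∧ σ ∈ nonnegOn P ∧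
      IsMidpointExtreme (nonnegOn P) σ ∧ ∀ τ ∈ nonnegOn P, σ ∈ closure (orbit G τ) := by
  obtain ⟨P, ⟨hinv, hne⟩, hmax⟩ := exists_maximal_nonnegOn G A
  obtain ⟨σ, hσP, hσ⟩ := exists_isMidpointExtreme (isClosed_nonnegOn P) hne
  refine ⟨P, σ, hinv, hσP, hσ, fun τ hτ => ?_⟩
  have hsub := closure_orbit_subset_nonnegOn hinv hτ
  let Q : Set A := {a | ∀ τ' ∈ closure (orbit G τ), 0 ≤ τ' a}
  have hQinv : ∀ (s : G), ∀ a ∈ Q, act s a ∈ Q := fun s a ha τ' hτ' => by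
    have := ha (s⁻¹ • τ') (smul_mem_closure_orbit s⁻¹ hτ')
    rwa [smul_apply, inv_inv] at this
  have hQP : Q ⊆ P := hmax ⟨hQinv, τ, fun a ha => ha τ (subset_closure (mem_orbit_self τ))⟩
    fun a ha τ' hτ' => hsub hτ' a ha
  exact mem_of_isMidpointExtreme isClosed_closure hsub hσ fun a ha => hσP a (hQP ha)

section Boundary

variable {σ : StateSpace A}

variable (G σ) in
/-- The inclusion of an orbit closure into the state space. -/
def orbitClosureIncl : C(orbitClosure G σ, StateSpace A) := ⟨_, continuous_subtype_val⟩

theorem isGMap_toFunctions_orbitClosureIncl : IsGMap G (toFunctions (orbitClosureIncl G σ)) :=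
  isGMap_toFunctions fun _ _ => rfl

theorem isStateProximal_orbitClosure (hinv : ∀ (s : G), ∀ a ∈ P, act s a ∈ P)
    (hσP : σ ∈ nonnegOn P) (hmem : ∀ τ ∈ nonnegOn P, σ ∈ closure (orbit G τ))
    (hσ : IsMidpointExtreme (nonnegOn P) σ) : IsStateProximal G (orbitClosure G σ) := fun τ => by
  have hq : ∀ y, orbitClosureIncl G σ y ∈ nonnegOn P :=
    fun y => closure_orbit_subset_nonnegOn hinv hσP y.2
  obtain ⟨τ', hτ', hbary⟩ := (image_closure_orbit (continuous_barycenter (orbitClosureIncl G σ))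
    (barycenter_smul fun _ _ => rfl) τ).ge (hmem _ (barycenter_mem_nonnegOn hq τ))
  obtain ⟨y, -, rfl⟩ :=
    exists_eq_pointState_of_barycenter_eq Subtype.val_injective hq hσ hbary
  exact ⟨y, hτ'⟩

end Boundary

end StateSpace

/-! ### Rigidity of boundaries -/

section Rigidity

open MulAction

theorem surjective_of_isMinimal {G X Y : Type*} [Group G] [TopologicalSpace X] [MulAction G X]
    [TopologicalSpace Y] [MulAction G Y] [CompactSpace X] [T2Space Y] [Nonempty X] [IsMinimal G Y]
    {f : X → Y} (hf : Continuous f) (hsmul : ∀ (s : G) x, f (s • x) = s • f x) :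
    Function.Surjective f := fun y => by
  obtain ⟨x⟩ := ‹Nonempty X›
  obtain ⟨x', -, hx'⟩ := (image_closure_orbit hf hsmul x).ge (dense_orbit G (f x) y)
  exact ⟨x', hx'⟩

/-- Every unital positive `G`-equivariant map from `A` to itself is the identity. -/
def IsGRigid (G A : Type*) [Group G] [Semiring A] [PartialOrder A] [Module ℂ A] [GAlgebra G A] :
    Prop :=
  ∀ θ : A →ₗ[ℂ] A, IsGMap G θ → θ = LinearMap.id

variable {G : Type u} [Group G] {X : Type v} [TopologicalSpace X] [CompactSpace X] [MulAction G X]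
  [ContinuousConstSMul G X] {B : Type w} [TopologicalSpace B] [CompactSpace B] [MulAction G B]
  [ContinuousConstSMul G B]

theorem isGMap_compStarAlgHom' {h : C(X, B)} (hh : ∀ (s : G) x, h (s • x) = s • h x) :
    IsGMap G (ContinuousMap.compStarAlgHom' ℂ ℂ h).toLinearMap where
  map_one := rfl
  map_nonneg _ hf x := hf (h x)
  map_act s f := ContinuousMap.ext fun x => congrArg f (hh s⁻¹ x).symm

namespace IsStateProximal

variable [IsMinimal G X] {θ : C(B, ℂ) →ₗ[ℂ] C(X, ℂ)}

/- The points of `X` with this property form a closed invariant set, which is nonempty by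
proximality. -/
theorem exists_comap_pointState_eq (hB : IsStateProximal G B) (hθ : IsGMap G θ) (x : X) :
    ∃ b, pointState b = (pointState x).comap hθ.toIsUnitalPositive := by
  let e : X → StateSpace C(B, ℂ) := fun x => (pointState x).comap hθ.toIsUnitalPositive
  have he : Continuous e := (StateSpace.continuous_comap _).comp continuous_pointState
  have hsmul : ∀ (s : G) x, e (s • x) = s • e x := fun s x => by
    simp only [e, pointState_smul, StateSpace.comap_smul hθ]
  obtain ⟨b, hb⟩ := hB (e x)
  rw [← image_closure_orbit he hsmul] at hb
  obtain ⟨x₁, -, hx₁⟩ := hb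
  refine closure_orbit_subset (K := e ⁻¹' Set.range pointState)
    ((isCompact_range continuous_pointState).isClosed.preimage he) ?_ ⟨b, hx₁.symm⟩
    (dense_orbit G x₁ x)
  rintro s y ⟨c, hc⟩
  exact ⟨s • c, by rw [pointState_smul, hc, hsmul]⟩

theorem exists_map (hB : IsStateProximal G B) [T2Space B] (hθ : IsGMap G θ) :
    ∃ h : X → B, Continuous h ∧ (∀ (s : G) x, h (s • x) = s • h x) ∧
      ∀ f x, θ f x = f (h x) := by
  choose h hh using hB.exists_comap_pointState_eq hθ
  refine ⟨h, ?_, fun s x => pointState_injective ?_, fun f x => (DFunLike.congr_fun (hh x) f).symm⟩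
  · rw [isClosedEmbedding_pointState.isInducing.continuous_iff]
    exact ((StateSpace.continuous_comap _).comp continuous_pointState).congr fun x => (hh x).symm
  · rw [hh, pointState_smul, pointState_smul, hh, StateSpace.comap_smul hθ]

theorem map_mul (hB : IsStateProximal G B) (hθ : IsGMap G θ) (f g : C(B, ℂ)) :
    θ (f * g) = θ f * θ g := ContinuousMap.ext fun x => by
  obtain ⟨b, hb⟩ := hB.exists_comap_pointState_eq hθ x
  have h (f : C(B, ℂ)) : θ f x = f b := (DFunLike.congr_fun hb f).symm
  rw [ContinuousMap.mul_apply, h, h, h, ContinuousMap.mul_apply]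

/- Both `θ` and its average with the identity are multiplicative, and a convex combination of
homomorphisms is a homomorphism only in the trivial case. -/
theorem isGRigid (hX : IsStateProximal G X) : IsGRigid G C(X, ℂ) := fun θ hθ => by
  ext f x
  have hmul := DFunLike.congr_fun (hX.map_mul hθ f f) x
  have hmid := DFunLike.congr_fun (hX.map_mul (hθ.midpoint .id) f f) x
  simp only [LinearMap.smul_apply, LinearMap.add_apply, LinearMap.id_apply, ContinuousMap.mul_apply,
    ContinuousMap.smul_apply, ContinuousMap.add_apply, smul_eq_mul] at hmul hmid
  rw [hmul] at hmid
  have hsq : (θ f x - f x) ^ 2 = 0 := by linear_combination 4 * hmid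
  exact sub_eq_zero.1 (pow_eq_zero_iff two_ne_zero |>.1 hsq)

end IsStateProximal

end Rigidity

/-! ### Rigid retracts of `ℓ^∞(G)` -/

section RigidRetract

open MulAction

/-- `A` is rigid and there are unital positive equivariant maps between `A` and `ℓ^∞(G)` in both
directions. By rigidity these maps exhibit `A` as a retract of `ℓ^∞(G)`. For `A = C(X)` this will
characterize Hamana boundaries. -/
structure IsRigidRetract (G : Type u) [Group G] (A : Type*) [Semiring A] [PartialOrder A]
    [Module ℂ A] [GAlgebra G A] : Prop where
  rigid : IsGRigid G A
  exists_to : ∃ α : A →ₗ[ℂ] EllInfty G, IsGMap G α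
  exists_from : ∃ β : EllInfty G →ₗ[ℂ] A, IsGMap G β

theorem isGMap_smulRight_one {G A B : Type*} [Group G] [Semiring A] [PartialOrder A] [Module ℂ A]
    [GAlgebra G A] [CStarAlgebra B] [PartialOrder B] [StarOrderedRing B] [GAlgebra G B]
    {σ : A →ₗ[ℂ] ℂ} (hσ : IsUnitalPositive σ) (hinv : ∀ (s : G) a, σ (act s a) = σ a) :
    IsGMap G (σ.smulRight (1 : B)) where
  map_one := by rw [LinearMap.smulRight_apply, hσ.map_one, one_smul]
  map_nonneg a ha := smul_nonneg (hσ.map_nonneg a ha) zero_le_one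
  map_act s a := by
    rw [LinearMap.smulRight_apply, LinearMap.smulRight_apply, hinv, map_smul,
      (isUnitalPositive_act s).map_one]

namespace IsRigidRetract

variable {G : Type u} [Group G]

theorem of_comp_eq_id {A B : Type*} [Semiring A] [PartialOrder A] [Module ℂ A] [GAlgebra G A]
    [Semiring B] [PartialOrder B] [Module ℂ B] [GAlgebra G B] (hA : IsRigidRetract G A)
    {φ : B →ₗ[ℂ] A} (hφ : IsGMap G φ) {ψ : A →ₗ[ℂ] B} (hψ : IsGMap G ψ)
    (h : ψ ∘ₗ φ = LinearMap.id) : IsRigidRetract G B := by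
  obtain ⟨α, hα⟩ := hA.exists_to
  obtain ⟨β, hβ⟩ := hA.exists_from
  refine ⟨fun θ hθ => ?_, ⟨_, hα.comp hφ⟩, ⟨_, hψ.comp hβ⟩⟩
  calc θ = (ψ ∘ₗ φ) ∘ₗ θ ∘ₗ (ψ ∘ₗ φ) := by rw [h, LinearMap.comp_id, LinearMap.id_comp]
    _ = ψ ∘ₗ (φ ∘ₗ θ ∘ₗ ψ) ∘ₗ φ := rfl
    _ = LinearMap.id := by rw [hA.rigid _ (hφ.comp (hθ.comp hψ)), LinearMap.id_comp, h]

variable {X : Type v} [TopologicalSpace X] [CompactSpace X] [MulAction G X]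
  [ContinuousConstSMul G X] {Y : Type w} [TopologicalSpace Y] [CompactSpace Y] [MulAction G Y]
  [ContinuousConstSMul G Y]

theorem of_isStateProximal (hX : IsStateProximal G X) [IsMinimal G X] [Nonempty X]
    {β : EllInfty G →ₗ[ℂ] C(X, ℂ)} (hβ : IsGMap G β) : IsRigidRetract G C(X, ℂ) :=
  ⟨hX.isGRigid, ‹Nonempty X›.elim fun x => ⟨_, isGMap_orbitHom x⟩, β, hβ⟩

variable (G) in
theorem exists_space : ∃ (X : Type u) (_ : TopologicalSpace X) (_ : CompactSpace X)
    (_ : T2Space X) (_ : MulAction G X) (_ : ContinuousConstSMul G X),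
    IsRigidRetract G C(X, ℂ) := by
  have : Nonempty (StateSpace (EllInfty G)) := ⟨⟨_, EllInfty.isUnitalPositive_eval 1⟩⟩
  obtain ⟨P, σ, hinv, hσP, hσ, hmem⟩ :=
    StateSpace.exists_isMidpointExtreme_mem_closure_orbit G (EllInfty G)
  have := StateSpace.isMinimal_orbitClosure_of_mem_nonnegOn hinv hσP hmem
  exact ⟨orbitClosure G σ, inferInstance, inferInstance, inferInstance, inferInstance,
    inferInstance, of_isStateProximal (StateSpace.isStateProximal_orbitClosure hinv hσP hmem hσ)
      StateSpace.isGMap_toFunctions_orbitClosureIncl⟩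

theorem nonempty (hX : IsRigidRetract G C(X, ℂ)) : Nonempty X := by
  by_contra h
  rw [not_nonempty_iff] at h
  obtain ⟨α, hα⟩ := hX.exists_to
  have hzero : (1 : EllInfty G) = 0 := by
    rw [← hα.map_one, Subsingleton.elim (1 : C(X, ℂ)) 0, map_zero]
  exact one_ne_zero (α := ℂ) (congrArg (fun f : EllInfty G => f 1) hzero)

/- Restriction of functions to an orbit is injective, as it is inverted by a map back from
`ℓ^∞(G)`. -/
theorem isMinimal [T2Space X] (hX : IsRigidRetract G C(X, ℂ)) : IsMinimal G X := by
  obtain ⟨β, hβ⟩ := hX.exists_from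
  refine ⟨fun x y => ?_⟩
  by_contra hy
  obtain ⟨f, hf0, hf1, -⟩ := exists_continuous_zero_one_of_isClosed
    (isClosed_closure (s := orbit G x)) (isClosed_singleton (x := y)) (by simpa using hy)
  let F := ofRealContinuousMap X f
  have hF : (orbitHom (G := G) x).toLinearMap F = 0 := EllInfty.ext fun t =>
    congrArg Complex.ofReal (hf0 (subset_closure ⟨t, rfl⟩))
  have hβF := DFunLike.congr_fun
    (LinearMap.congr_fun (hX.rigid _ (hβ.comp (isGMap_orbitHom x))) F) y
  rw [LinearMap.comp_apply, hF, map_zero] at hβF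
  have hFy : F y = 1 := congrArg Complex.ofReal (hf1 rfl)
  exact zero_ne_one (hβF.trans hFy)

/- The Poisson map of `τ` is inverted by a positive map, so a function that is nonnegative on the
orbit of `τ` is nonnegative. -/
theorem isStateProximal (hX : IsRigidRetract G C(X, ℂ)) : IsStateProximal G X := fun τ => by
  obtain ⟨β, hβ⟩ := hX.exists_from
  obtain ⟨x⟩ := hX.nonempty
  refine ⟨x, StateSpace.mem_of_isMidpointExtreme isClosed_closure (fun _ _ _ => False.elim)
    (StateSpace.isMidpointExtreme_pointState x) fun f hf => ?_⟩
  have hpos : 0 ≤ β (StateSpace.poissonMap τ f) :=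
    hβ.map_nonneg _ fun t => hf (t • τ) (subset_closure ⟨t, rfl⟩)
  have hid : β (StateSpace.poissonMap τ f) = f :=
    LinearMap.congr_fun (hX.rigid _ (hβ.comp (StateSpace.isGMap_poissonMap τ))) f
  exact (hid ▸ hpos : 0 ≤ f) x

variable [T2Space X] [T2Space Y]

theorem isGBoundary (hX : IsRigidRetract G C(X, ℂ)) : IsGBoundary G X :=
  ⟨hX.nonempty, inferInstance, inferInstance, hX.isMinimal,
    isStronglyProximal_iff.2 hX.isStateProximal⟩

theorem isGImage (hX : IsRigidRetract G C(X, ℂ)) (hY : IsGBoundary G Y) : IsGImage G X Y := by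
  obtain ⟨β, hβ⟩ := hX.exists_from
  obtain ⟨y⟩ := hY.nonempty
  have := hX.nonempty
  have := hX.isMinimal
  have := hY.minimal
  obtain ⟨h, hcont, hsmul, -⟩ :=
    (isStronglyProximal_iff.1 hY.stronglyProximal).exists_map (hβ.comp (isGMap_orbitHom y))
  exact ⟨h, hcont, surjective_of_isMinimal hcont hsmul, hsmul⟩

theorem exists_homeomorph (hX : IsRigidRetract G C(X, ℂ)) (hY : IsRigidRetract G C(Y, ℂ)) :
    ∃ h : X ≃ₜ Y, ∀ (s : G) (x : X), h (s • x) = s • h x := by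
  obtain ⟨α, hα⟩ := hX.exists_to
  obtain ⟨β, hβ⟩ := hX.exists_from
  obtain ⟨α', hα'⟩ := hY.exists_to
  obtain ⟨β', hβ'⟩ := hY.exists_from
  have := hX.nonempty
  have := hX.isMinimal
  have := hY.isMinimal
  obtain ⟨h, hcont, hsmul, hh⟩ := hY.isStateProximal.exists_map (hβ.comp hα')
  have hid := hX.rigid _ ((hβ.comp hα').comp (hβ'.comp hα))
  have hinj : Function.Injective h := fun x y hxy =>
    pointState_injective <| StateSpace.ext fun f => by
      rw [← LinearMap.id_apply (R := ℂ) f, ← hid, LinearMap.comp_apply, pointState_apply,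
        pointState_apply, hh, hh, hxy]
  let e := Equiv.ofBijective h ⟨hinj, surjective_of_isMinimal hcont hsmul⟩
  exact ⟨Continuous.homeoOfEquivCompactToT2 (f := e) hcont, hsmul⟩

theorem subsingleton_iff (hX : IsRigidRetract G C(X, ℂ)) : Subsingleton X ↔ IsAmenable G := by
  constructor
  · intro
    obtain ⟨β, hβ⟩ := hX.exists_from
    obtain ⟨x⟩ := hX.nonempty
    let m := (pointState x).comap hβ.toIsUnitalPositive
    refine ⟨m.1, m.apply_one, fun _ => m.apply_nonneg, fun s f => ?_⟩
    change β (act s f) x = β f x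
    rw [hβ.map_act, act_continuousMap_apply, Subsingleton.elim (s⁻¹ • x) x]
  · rintro ⟨m, hm1, hmpos, hminv⟩
    obtain ⟨α, hα⟩ := hX.exists_to
    have hid := hX.rigid _ ((isGMap_smulRight_one ⟨hm1, hmpos⟩ hminv).comp hα)
    exact ⟨fun x y => pointState_injective <| StateSpace.ext fun f => by
      rw [← LinearMap.id_apply (R := ℂ) f, ← hid]
      rfl⟩

end IsRigidRetract

theorem IsFurstenbergBoundary.isRigidRetract {G X : Type u} [Group G] [TopologicalSpace X]
    [CompactSpace X] [T2Space X] [MulAction G X] [ContinuousConstSMul G X]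
    (hX : IsFurstenbergBoundary G X) : IsRigidRetract G C(X, ℂ) := by
  obtain ⟨X₀, _, _, _, _, _, hX₀⟩ := IsRigidRetract.exists_space G
  obtain ⟨β, hβ⟩ := hX₀.exists_from
  obtain ⟨h, hcont, -, hsmul⟩ := hX.2 X₀ hX₀.isGBoundary
  have := hX.1.nonempty
  have := hX.1.minimal
  exact .of_isStateProximal (isStronglyProximal_iff.1 hX.1.stronglyProximal)
    ((isGMap_compStarAlgHom' (h := ⟨h, hcont⟩) hsmul).comp hβ)

theorem isFurstenbergBoundary_iff_isRigidRetract {G X : Type u} [Group G] [TopologicalSpace X]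
    [CompactSpace X] [T2Space X] [MulAction G X] [ContinuousConstSMul G X] :
    IsFurstenbergBoundary G X ↔ IsRigidRetract G C(X, ℂ) :=
  ⟨IsFurstenbergBoundary.isRigidRetract, fun hX => ⟨hX.isGBoundary, fun B _ _ _ hB => by
    have := hB.compact
    have := hB.hausdorff
    exact hX.isGImage hB⟩⟩

end RigidRetract

/-! ### Minimal projections on `ℓ^∞(G)` -/

section Projections

open EllInfty

variable {G : Type u} [Group G] {ψ : EllInfty G →ₗ[ℂ] EllInfty G}

theorem EllInfty.IsGProjection.isGMap (hψ : IsGProjection ψ) : IsGMap G ψ :=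
  ⟨⟨hψ.unital, hψ.positive⟩, hψ.equivariant⟩

section Rigid

variable {A : Type*} [Semiring A] [PartialOrder A] [Module ℂ A] [GAlgebra G A]
  {α : A →ₗ[ℂ] EllInfty G} {β : EllInfty G →ₗ[ℂ] A}

theorem isGProjection_comp (hα : IsGMap G α) (hβ : IsGMap G β) (h : β ∘ₗ α = LinearMap.id) :
    IsGProjection (α ∘ₗ β) where
  unital := (hα.comp hβ).map_one
  positive := (hα.comp hβ).map_nonneg
  equivariant := (hα.comp hβ).map_act
  idempotent f := congrArg α (LinearMap.congr_fun h (β f))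

/- By rigidity, a projection onto a subspace of the range of `α` fixes the range of `α`. -/
theorem IsGRigid.isMinimalGProjection_comp (hA : IsGRigid G A) (hα : IsGMap G α)
    (hβ : IsGMap G β) : IsMinimalGProjection (α ∘ₗ β) := by
  have hβα := hA _ (hβ.comp hα)
  refine ⟨isGProjection_comp hα hβ hβα, fun ψ hψ hle => le_antisymm hle ?_⟩
  rintro _ ⟨f, rfl⟩
  obtain ⟨g, hg⟩ := hle ⟨α (β f), rfl⟩
  have hgf : β g = β f := calc
    β g = β (α (β g)) := (LinearMap.congr_fun hβα (β g)).symm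
    _ = β (ψ (α (β f))) := congrArg β hg
    _ = β f := LinearMap.congr_fun (hA _ (hβ.comp (hψ.isGMap.comp hα))) (β f)
  exact ⟨α (β f), by rw [← hg, LinearMap.comp_apply, LinearMap.comp_apply, hgf]⟩

theorem EllInfty.IsMinimalGProjection.range_comp_eq (hψ : IsMinimalGProjection ψ)
    (hA : IsGRigid G A) (hα : IsGMap G α) (hβ : IsGMap G β) :
    LinearMap.range (ψ ∘ₗ α) = LinearMap.range ψ := by
  have hψα := hψ.projection.isGMap.comp hα
  have hle : LinearMap.range (ψ ∘ₗ α) ≤ LinearMap.range ψ := LinearMap.range_comp_le_range α ψ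
  have hle' : LinearMap.range ((ψ ∘ₗ α) ∘ₗ β) ≤ LinearMap.range (ψ ∘ₗ α) :=
    LinearMap.range_comp_le_range β _
  refine hle.antisymm (le_of_eq_of_le (hψ.minimal _ ?_ (hle'.trans hle)).symm hle')
  exact isGProjection_comp hψα hβ (hA _ (hβ.comp hψα))

end Rigid

variable {X : Type v} [TopologicalSpace X] [CompactSpace X] [MulAction G X]
  [ContinuousConstSMul G X] {j : C(X, ℂ) →ₗ[ℂ] EllInfty G}

theorem EllInfty.IsGProjection.isImageIso (hψ : IsGProjection ψ) (hj : IsGMap G j)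
    {β : EllInfty G →ₗ[ℂ] C(X, ℂ)} (hβ : IsGMap G β) (h : β ∘ₗ j = LinearMap.id)
    (hrange : LinearMap.range j = LinearMap.range ψ) : IsImageIso ψ j := by
  have hβj (f : C(X, ℂ)) : β (j f) = f := LinearMap.congr_fun h f
  have hψj (f : C(X, ℂ)) : ψ (j f) = j f := by
    obtain ⟨g, hg⟩ := hrange.le ⟨f, rfl⟩
    rw [← hg, hψ.idempotent]
  refine ⟨hrange, fun f => (hj.norm_map_le f).antisymm ?_, hj.map_one, hj.map_star,
    fun f g => ?_, hj.map_act⟩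
  · exact (congrArg norm (hβj f)).symm.trans_le (hβ.norm_map_le (j f))
  · have hid : (β ∘ₗ ψ) ∘ₗ j = LinearMap.id := LinearMap.ext fun f =>
      (congrArg β (hψj f)).trans (hβj f)
    have hmul : β (ψ (j f * j g)) = f * g :=
      hj.map_mul_of_comp_eq_id (hβ.comp hψ.isGMap).toIsUnitalPositive hid f g
    obtain ⟨h, hh⟩ := hrange.ge ⟨j f * j g, rfl⟩
    rw [← hmul, ← hh, hβj]

namespace IsRigidRetract

theorem exists_isImageIso (hX : IsRigidRetract G C(X, ℂ)) (hψ : IsMinimalGProjection ψ) :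
    ∃ j : C(X, ℂ) →ₗ[ℂ] EllInfty G, IsImageIso ψ j := by
  obtain ⟨α, hα⟩ := hX.exists_to
  obtain ⟨β, hβ⟩ := hX.exists_from
  have hj := hψ.projection.isGMap.comp hα
  exact ⟨ψ ∘ₗ α, hψ.projection.isImageIso hj hβ (hX.rigid _ (hβ.comp hj))
    (hψ.range_comp_eq hX.rigid hα hβ)⟩

theorem exists_isImageIso_starAlgHom (hX : IsRigidRetract G C(X, ℂ)) :
    ∃ (ψ : EllInfty G →ₗ[ℂ] EllInfty G) (j : C(X, ℂ) →⋆ₐ[ℂ] EllInfty G),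
      IsMinimalGProjection ψ ∧ IsImageIso ψ j.toLinearMap := by
  obtain ⟨x⟩ := hX.nonempty
  obtain ⟨β, hβ⟩ := hX.exists_from
  have hj := isGMap_orbitHom (G := G) x
  have hψ := hX.rigid.isMinimalGProjection_comp hj hβ
  have hβj := hX.rigid _ (hβ.comp hj)
  refine ⟨_, orbitHom x, hψ, hψ.projection.isImageIso hj hβ hβj <|
    le_antisymm ?_ (LinearMap.range_comp_le_range _ _)⟩
  rw [LinearMap.range_comp_of_range_eq_top _
    (LinearMap.range_eq_top.2 (LinearMap.surjective_of_comp_eq_id _ _ hβj))]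

end IsRigidRetract

namespace EllInfty.IsImageIso

theorem injective (hj : IsImageIso ψ j) : Function.Injective j :=
  (injective_iff_map_eq_zero j).2 fun f hf => by rw [← norm_eq_zero, ← hj.norm_map, hf, norm_zero]

theorem isGMap (hj : IsImageIso ψ j) : IsGMap G j where
  map_one := hj.map_one
  map_nonneg f hf t := IsUnitalPositive.map_nonneg (φ := eval t ∘ₗ j)
    (.of_norm_apply_le (congrArg (eval t) hj.map_one) fun f =>
      ((isUnitalPositive_eval t).norm_apply_le_norm (j f)).trans_eq (hj.norm_map f)) f hf
  map_act := hj.equivariant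

/- Positivity of `j⁻¹ ∘ ψ`: as `j` is isometric, point evaluations on `X` extend along `j` to states
of `ℓ^∞(G)`. -/
theorem exists_comp_eq (hψ : IsGProjection ψ) (hj : IsImageIso ψ j) :
    ∃ ρ : EllInfty G →ₗ[ℂ] C(X, ℂ), IsGMap G ρ ∧ j ∘ₗ ρ = ψ := by
  let ρ := (LinearEquiv.ofInjective j hj.injective).symm.toLinearMap ∘ₗ
    ψ.codRestrict (LinearMap.range j) fun f => hj.range_eq.ge ⟨f, rfl⟩
  have hjρ (f : EllInfty G) : j (ρ f) = ψ f :=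
    congrArg Subtype.val ((LinearEquiv.ofInjective j hj.injective).apply_symm_apply _)
  refine ⟨ρ, ⟨⟨hj.injective ?_, fun f hf x => ?_⟩, fun s f => hj.injective ?_⟩,
    LinearMap.ext hjρ⟩
  · rw [hjρ, hψ.unital, hj.map_one]
  · obtain ⟨τ, hτ, hτj⟩ := exists_isUnitalPositive_comp_eq (σ := (pointState x).1) hj.map_one rfl
      fun f => ((pointState x).norm_apply_le f).trans_eq (hj.norm_map f).symm
    have hτρ : τ (ψ f) = ρ f x := by
      rw [← hjρ]
      exact LinearMap.congr_fun hτj (ρ f)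
    exact (hτ.map_nonneg _ (hψ.positive f hf)).trans_eq hτρ
  · rw [hjρ, hj.isGMap.map_act, hjρ]
    exact hψ.equivariant s f

theorem isRigidRetract (hj : IsImageIso ψ j) (hψ : IsMinimalGProjection ψ) {A : Type*}
    [Semiring A] [PartialOrder A] [Module ℂ A] [GAlgebra G A] (hA : IsRigidRetract G A) :
    IsRigidRetract G C(X, ℂ) := by
  obtain ⟨α, hα⟩ := hA.exists_to
  obtain ⟨β, hβ⟩ := hA.exists_from
  obtain ⟨ρ, hρ, hjρ⟩ := hj.exists_comp_eq hψ.projection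
  have hβψα := hA.rigid _ (hβ.comp (hψ.projection.isGMap.comp hα))
  refine hA.of_comp_eq_id (hβ.comp hj.isGMap) (hρ.comp hα) (LinearMap.ext fun f => hj.injective ?_)
  obtain ⟨a, ha⟩ : j f ∈ LinearMap.range (ψ ∘ₗ α) := by
    rw [hψ.range_comp_eq hA.rigid hα hβ, ← hj.range_eq]
    exact ⟨f, rfl⟩
  calc j (ρ (α (β (j f)))) = ψ (α (β (j f))) := LinearMap.congr_fun hjρ _
    _ = ψ (α (β (ψ (α a)))) := by rw [← ha, LinearMap.comp_apply]
    _ = ψ (α a) := congrArg (ψ ∘ₗ α) (LinearMap.congr_fun hβψα a)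
    _ = j f := ha

end EllInfty.IsImageIso

end Projections

/-! ### Injective envelopes -/

namespace GOperatorSystem

variable {G : Type u} [Group G]

theorem isOperatorSystem_subtype (T : GOperatorSystem.{u, v} G) :
    IsOperatorSystem T.carrier.subtype :=
  ⟨⟨T.unit, rfl⟩, fun x => ⟨⟨_, T.star_mem x x.2⟩, rfl⟩⟩

section Maps

variable {S : GOperatorSystem.{u, v} G} {T : GOperatorSystem.{u, w} G}
  {φ : S.carrier →ₗ[ℂ] T.carrier} {ψ : T.carrier →ₗ[ℂ] S.carrier}

theorem IsCompletelyPositive.map_nonneg (hφ : IsCompletelyPositive φ) {x : S.carrier}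
    (hx : 0 ≤ (x : S.Ambient)) : 0 ≤ (φ x : T.Ambient) :=
  (map_oneByOne_nonneg_iff x fun x => (φ x : T.Ambient)).1
    (hφ 1 _ ((map_oneByOne_nonneg_iff x fun x => (x : S.Ambient)).2 hx))

theorem IsCompletelyIsometric.norm_map (hφ : IsCompletelyIsometric φ) (x : S.carrier) :
    ‖(φ x : T.Ambient)‖ = ‖(x : S.Ambient)‖ := by
  rw [← norm_map_oneByOne x fun x => (φ x : T.Ambient),
    ← norm_map_oneByOne x fun x => (x : S.Ambient)]
  exact hφ 1 _

theorem IsCompletelyPositive.norm_map_le (hφ : IsCompletelyPositive φ) (h1 : IsUnital φ) {n : ℕ}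
    (M : CStarMatrix (Fin n) (Fin n) S.carrier) :
    ‖M.map (fun x => (φ x : T.Ambient))‖ ≤ ‖M.map (fun x => (x : S.Ambient))‖ := by
  refine norm_map_le_of_forall_map_nonneg (k := T.carrier.subtype ∘ₗ φ) S.isOperatorSystem_subtype
    (fun u hu => ?_) (fun _ => map_nonneg_of_forall_fin hφ) M
  have hu' : u = S.unit := Subtype.ext hu
  rw [hu', LinearMap.comp_apply, h1]
  rfl

theorem IsCompletelyPositive.isCompletelyIsometric_of_comp_eq_id (hφ : IsCompletelyPositive φ)
    (hφ1 : IsUnital φ) (hψ : IsCompletelyPositive ψ) (hψ1 : IsUnital ψ)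
    (h : ψ ∘ₗ φ = LinearMap.id) : IsCompletelyIsometric φ := fun n M => by
  refine (hφ.norm_map_le hφ1 M).antisymm ?_
  have hM : (M.map φ).map (fun x => (ψ x : S.Ambient)) = M.map (fun x => (x : S.Ambient)) := by
    ext i j
    exact congrArg Subtype.val (LinearMap.congr_fun h (M i j))
  exact hM ▸ hψ.norm_map_le hψ1 (M.map φ)

theorem IsGUCP.id : IsGUCP (LinearMap.id : S.carrier →ₗ[ℂ] S.carrier) :=
  ⟨rfl, fun _ _ h => h, fun _ _ => rfl⟩

theorem IsGUCP.comp {R : GOperatorSystem G} {φ : R.carrier →ₗ[ℂ] S.carrier}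
    {ψ : S.carrier →ₗ[ℂ] T.carrier} (hψ : IsGUCP ψ) (hφ : IsGUCP φ) : IsGUCP (ψ ∘ₗ φ) where
  unital := (congrArg ψ hφ.unital).trans hψ.unital
  completelyPositive n M hM := hψ.completelyPositive n (M.map φ) (hφ.completelyPositive n M hM)
  equivariant s x := (congrArg ψ (hφ.equivariant s x)).trans (hψ.equivariant s (φ x))

theorem exists_isState_comp_eq {ι : S.carrier →ₗ[ℂ] T.carrier} (h1 : IsUnital ι)
    (hι : ∀ x : S.carrier, ‖(x : S.Ambient)‖ ≤ ‖(ι x : T.Ambient)‖) {σ : S.carrier →ₗ[ℂ] ℂ}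
    (hσ : IsState S.carrier.subtype σ) :
    ∃ τ : T.carrier →ₗ[ℂ] ℂ, IsState T.carrier.subtype τ ∧ τ ∘ₗ ι = σ := by
  obtain ⟨τ, hτ, hext⟩ := exists_isUnitalPositive_comp_eq (j := T.carrier.subtype ∘ₗ ι)
    (congrArg Subtype.val h1) (hσ.map_eq_one S.unit rfl)
    fun x => (hσ.norm_apply_le S.isOperatorSystem_subtype x).trans (hι x)
  exact ⟨τ ∘ₗ T.carrier.subtype, ⟨fun _ hx => (congrArg τ hx).trans hτ.map_one,
    fun x => hτ.map_nonneg x⟩, hext⟩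

end Maps

section States

variable {T : GOperatorSystem.{u, v} G} {τ : T.carrier →ₗ[ℂ] ℂ}

theorem isState_comp_act (hτ : IsState T.carrier.subtype τ) (s : G) :
    IsState T.carrier.subtype (τ ∘ₗ T.act s) where
  map_eq_one x hx := by
    have hx' : x = T.unit := Subtype.ext hx
    exact hx' ▸ hτ.map_eq_one _ (congrArg Subtype.val (T.act_one s))
  map_nonneg x hx := hτ.map_nonneg _ <|
    (map_oneByOne_nonneg_iff x fun x => (T.act s x : T.Ambient)).1
      (T.act_completelyPositive s 1 _ ((map_oneByOne_nonneg_iff x Subtype.val).2 hx))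

theorem exists_norm_apply_act_inv_le (hτ : IsState T.carrier.subtype τ) (x : T.carrier) :
    ∃ c, ∀ t, ‖τ (T.act t⁻¹ x)‖ ≤ c :=
  ⟨_, fun t => (isState_comp_act hτ t⁻¹).norm_apply_le T.isOperatorSystem_subtype x⟩

end States

section ContinuousFunctions

variable (G) in
/-- The underlying space of the operator system `ℂ`. -/
def complexEquiv : (complex G).carrier ≃ₗ[ℂ] ℂ where
  toFun f := f.1
  invFun f := ⟨f, trivial⟩
  map_add' _ _ := rfl
  map_smul' _ _ := rfl
  left_inv _ := rfl
  right_inv _ := rfl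

variable (X : Type v) [TopologicalSpace X] [CompactSpace X] [MulAction G X]
  [ContinuousConstSMul G X]

variable (G) in
/-- The underlying space of the operator system `C(X)`. -/
def continuousFunctionsEquiv : (continuousFunctions G X).carrier ≃ₗ[ℂ] C(X, ℂ) where
  toFun f := f.1
  invFun f := ⟨f, trivial⟩
  map_add' _ _ := rfl
  map_smul' _ _ := rfl
  left_inv _ := rfl
  right_inv _ := rfl

variable {X}

theorem isGUCP_continuousFunctionsEquiv_symm_comp {T : GOperatorSystem.{u, w} G}
    {η : T.carrier →ₗ[ℂ] C(X, ℂ)} (h1 : η T.unit = 1)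
    (hpos : ∀ x : T.carrier, 0 ≤ (x : T.Ambient) → 0 ≤ η x)
    (hact : ∀ s x, η (T.act s x) = GAlgebra.act s (η x)) :
    IsGUCP ((continuousFunctionsEquiv G X).symm.toLinearMap ∘ₗ η) where
  unital := Subtype.ext h1
  completelyPositive n M hM := by
    refine map_nonneg_of_forall_isState (φ := η) T.isOperatorSystem_subtype (fun x => ?_) hM
    refine ⟨fun u hu => ?_, fun y hy => hpos y hy x⟩
    have hu' : u = T.unit := Subtype.ext hu
    exact hu' ▸ DFunLike.congr_fun h1 x
  equivariant s x := Subtype.ext (hact s x)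

theorem IsGUCP.isGMap {Y : Type w} [TopologicalSpace Y] [CompactSpace Y] [MulAction G Y]
    [ContinuousConstSMul G Y]
    {φ : (continuousFunctions G X).carrier →ₗ[ℂ] (continuousFunctions G Y).carrier}
    (hφ : IsGUCP φ) :
    IsGMap G ((continuousFunctionsEquiv G Y).toLinearMap ∘ₗ φ ∘ₗ
      (continuousFunctionsEquiv G X).symm.toLinearMap) where
  map_one := congrArg Subtype.val hφ.unital
  map_nonneg f hf :=
    hφ.completelyPositive.map_nonneg (x := (continuousFunctionsEquiv G X).symm f) hf
  map_act s f := congrArg Subtype.val (hφ.equivariant s ((continuousFunctionsEquiv G X).symm f))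

theorem eq_id_of_isGRigid (hX : IsGRigid G C(X, ℂ))
    {θ : (continuousFunctions G X).carrier →ₗ[ℂ] (continuousFunctions G X).carrier}
    (hθ : IsGUCP θ) : θ = LinearMap.id :=
  LinearMap.ext fun f => Subtype.ext <|
    LinearMap.congr_fun (hX _ hθ.isGMap) (continuousFunctionsEquiv G X f)

variable (G X) in
/-- The embedding of `ℂ` as the constant functions. -/
def constants : (complex G).carrier →ₗ[ℂ] (continuousFunctions G X).carrier :=
  (continuousFunctionsEquiv G X).symm.toLinearMap ∘ₗ
    (complexEquiv G).toLinearMap.smulRight (1 : C(X, ℂ))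

theorem isGUCP_constants : IsGUCP (constants G X) :=
  isGUCP_continuousFunctionsEquiv_symm_comp (T := complex G) (one_smul ℂ _)
    (fun _ hc _ => mul_nonneg hc zero_le_one) fun _ _ => rfl

theorem eq_constants_of_isUnital {ι : (complex G).carrier →ₗ[ℂ] (continuousFunctions G X).carrier}
    (h1 : IsUnital ι) : ι = constants G X := LinearMap.ext fun c => by
  have hc : c = complexEquiv G c • (complex G).unit :=
    Subtype.ext (mul_one (complexEquiv G c)).symm
  rw [hc, map_smul, map_smul, h1, isGUCP_constants.unital]

/- Evaluation at a point of `X` is a completely positive left inverse. -/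
theorem isGExtension_constants [Nonempty X] : IsGExtension (constants G X) where
  unital := isGUCP_constants.unital
  equivariant := isGUCP_constants.equivariant
  completelyIsometric := by
    obtain ⟨x⟩ := ‹Nonempty X›
    let σ := (pointState x).1 ∘ₗ (continuousFunctionsEquiv G X).toLinearMap
    have hσ : IsState (continuousFunctions G X).carrier.subtype σ :=
      ⟨fun _ hf => (congrArg (pointState x) hf).trans (pointState x).apply_one, fun _ hf => hf x⟩
    exact isGUCP_constants.completelyPositive.isCompletelyIsometric_of_comp_eq_id
      isGUCP_constants.unital (ψ := (complexEquiv G).symm.toLinearMap ∘ₗ σ)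
      (fun _ M hM => hσ.map_cstarMatrix_nonneg (isOperatorSystem_subtype _) hM) rfl
      (LinearMap.ext fun c => Subtype.ext (mul_one (complexEquiv G c)))

theorem isGUCP_comp_poissonMap {T : GOperatorSystem.{u, w} G} {τ : T.carrier →ₗ[ℂ] ℂ}
    (hτ : IsState T.carrier.subtype τ) {β : EllInfty G →ₗ[ℂ] C(X, ℂ)} (hβ : IsGMap G β) :
    IsGUCP ((continuousFunctionsEquiv G X).symm.toLinearMap ∘ₗ β ∘ₗ
      poissonMap T.act τ (exists_norm_apply_act_inv_le hτ)) := by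
  refine isGUCP_continuousFunctionsEquiv_symm_comp ?_ (fun x hx => ?_) fun s x => ?_
  · have hunit : poissonMap T.act τ (exists_norm_apply_act_inv_le hτ) T.unit = 1 :=
      EllInfty.ext fun t => (isState_comp_act hτ t⁻¹).map_eq_one _ rfl
    rw [LinearMap.comp_apply, hunit, hβ.map_one]
  · exact hβ.map_nonneg _ fun t => (isState_comp_act hτ t⁻¹).map_nonneg x hx
  · rw [LinearMap.comp_apply, poissonMap_map, hβ.map_act, LinearMap.comp_apply]

theorem exists_isGUCP_of_isCompletelyIsometric {T : GOperatorSystem.{u, w} G}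
    {κ : (complex G).carrier →ₗ[ℂ] T.carrier} (h1 : IsUnital κ) (hκ : IsCompletelyIsometric κ)
    {β : EllInfty G →ₗ[ℂ] C(X, ℂ)} (hβ : IsGMap G β) :
    ∃ φ : T.carrier →ₗ[ℂ] (continuousFunctions G X).carrier, IsGUCP φ := by
  have hσ : IsState (complex G).carrier.subtype (complexEquiv G).toLinearMap :=
    ⟨fun _ hc => hc, fun _ hc => hc⟩
  obtain ⟨τ, hτ, -⟩ := exists_isState_comp_eq h1 (fun c => (hκ.norm_map c).ge) hσ
  exact ⟨_, isGUCP_comp_poissonMap hτ hβ⟩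

/- An equivariant map into `ℓ^∞(G)` is determined by its composition with the evaluation at `1`,
so to extend it is to extend a state. -/
theorem isGInjective_continuousFunctions {α : C(X, ℂ) →ₗ[ℂ] EllInfty G} (hα : IsGMap G α)
    {β : EllInfty G →ₗ[ℂ] C(X, ℂ)} (hβ : IsGMap G β) (h : β ∘ₗ α = LinearMap.id) :
    IsGInjective (continuousFunctions G X) := fun S T ι φ hι hφ => by
  let φ' : S.carrier →ₗ[ℂ] EllInfty G :=
    α ∘ₗ (continuousFunctionsEquiv G X).toLinearMap ∘ₗ φ
  have hφ'1 : φ' S.unit = 1 :=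
    (congrArg (α ∘ₗ (continuousFunctionsEquiv G X).toLinearMap) hφ.unital).trans hα.map_one
  have hφ'act (s : G) (x : S.carrier) : φ' (S.act s x) = GAlgebra.act s (φ' x) :=
    (congrArg (α ∘ₗ (continuousFunctionsEquiv G X).toLinearMap) (hφ.equivariant s x)).trans
      (hα.map_act s _)
  have hσ : IsState S.carrier.subtype (EllInfty.eval 1 ∘ₗ φ') := by
    refine ⟨fun u hu => ?_, fun x hx => hα.map_nonneg _ (hφ.completelyPositive.map_nonneg hx) 1⟩
    have hu' : u = S.unit := Subtype.ext hu
    exact hu' ▸ congrArg (EllInfty.eval 1) hφ'1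
  obtain ⟨τ, hτ, hext⟩ :=
    exists_isState_comp_eq hι.unital (fun x => (hι.completelyIsometric.norm_map x).ge) hσ
  have hpoisson (x : S.carrier) :
      poissonMap T.act τ (exists_norm_apply_act_inv_le hτ) (ι x) = φ' x :=
    EllInfty.ext fun t => by
      rw [poissonMap_apply, ← hι.equivariant, apply_eq_apply_one_of_equivariant hφ'act]
      exact LinearMap.congr_fun hext (S.act t⁻¹ x)
  exact ⟨_, isGUCP_comp_poissonMap hτ hβ, LinearMap.ext fun x => Subtype.ext <|
    (congrArg β (hpoisson x)).trans (LinearMap.congr_fun h _)⟩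

theorem isGEssential_constants (hX : IsGRigid G C(X, ℂ)) {β : EllInfty G →ₗ[ℂ] C(X, ℂ)}
    (hβ : IsGMap G β) : IsGEssential (constants G X) := fun T φ hφ hiso => by
  obtain ⟨η, hη⟩ := exists_isGUCP_of_isCompletelyIsometric (hφ.comp isGUCP_constants).unital hiso hβ
  exact hφ.completelyPositive.isCompletelyIsometric_of_comp_eq_id hφ.unital
    hη.completelyPositive hη.unital (eq_id_of_isGRigid hX (hη.comp hφ))

end ContinuousFunctions

end GOperatorSystem

section HamanaBoundary

open GOperatorSystem

variable {G : Type u} [Group G]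

theorem IsRigidRetract.isHamanaBoundary {X : Type v} [TopologicalSpace X] [CompactSpace X]
    [MulAction G X] [ContinuousConstSMul G X] (hX : IsRigidRetract G C(X, ℂ)) :
    IsHamanaBoundary G X := by
  obtain ⟨α, hα⟩ := hX.exists_to
  obtain ⟨β, hβ⟩ := hX.exists_from
  have := hX.nonempty
  exact ⟨constants G X, isGExtension_constants,
    isGInjective_continuousFunctions hα hβ (hX.rigid _ (hβ.comp hα)),
    isGEssential_constants hX.rigid hβ⟩

theorem IsRigidRetract.exists_equiv {X : Type v} [TopologicalSpace X] [CompactSpace X]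
    [MulAction G X] [ContinuousConstSMul G X] (hX : IsRigidRetract G C(X, ℂ))
    {U : GOperatorSystem.{u, v} G} {κ : (complex G).carrier →ₗ[ℂ] U.carrier}
    (hκ : IsGInjectiveEnvelope κ) :
    ∃ φ : U.carrier ≃ₗ[ℂ] (continuousFunctions G X).carrier,
      IsGExtension φ.toLinearMap ∧ IsGUCP φ.toLinearMap ∧ IsGUCP φ.symm.toLinearMap := by
  obtain ⟨β, hβ⟩ := hX.exists_from
  have := hX.nonempty
  obtain ⟨φ, hφ⟩ := exists_isGUCP_of_isCompletelyIsometric hκ.extension.unital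
    hκ.extension.completelyIsometric hβ
  have hφκ : φ ∘ₗ κ = constants G X :=
    eq_constants_of_isUnital ((congrArg φ hκ.extension.unital).trans hφ.unital)
  have hiso : IsCompletelyIsometric φ := hκ.essential _ φ hφ <| by
    rw [hφκ]
    exact isGExtension_constants.completelyIsometric
  have hext : IsGExtension φ := ⟨hφ.unital, hiso, hφ.equivariant⟩
  obtain ⟨θ, hθ, hθφ⟩ := hκ.injective _ _ φ LinearMap.id hext .id
  have hφθ : φ ∘ₗ θ = LinearMap.id := eq_id_of_isGRigid hX.rigid (hφ.comp hθ)
  exact ⟨.ofLinearMap φ θ hφθ hθφ, hext, hφ, hθ⟩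

variable {X : Type u} [TopologicalSpace X] [CompactSpace X] [MulAction G X]
  [ContinuousConstSMul G X]

theorem IsHamanaBoundary.isRigidRetract (hX : IsHamanaBoundary G X) :
    IsRigidRetract G C(X, ℂ) := by
  obtain ⟨X₀, _, _, _, _, _, hX₀⟩ := IsRigidRetract.exists_space G
  obtain ⟨κ, hκ⟩ := hX
  obtain ⟨φ, -, hφ, hφ'⟩ := hX₀.exists_equiv hκ
  exact hX₀.of_comp_eq_id hφ.isGMap hφ'.isGMap <| LinearMap.ext fun f =>
    congrArg (continuousFunctionsEquiv G X) (φ.symm_apply_apply _)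

theorem isHamanaBoundary_iff_isRigidRetract :
    IsHamanaBoundary G X ↔ IsRigidRetract G C(X, ℂ) :=
  ⟨IsHamanaBoundary.isRigidRetract, IsRigidRetract.isHamanaBoundary⟩

end HamanaBoundary

end

theorem mainTheorem4 (G : Type u) [Group G] :
    -- the Hamana boundary exists
    (∃ (X : Type u) (_ : TopologicalSpace X) (_ : CompactSpace X) (_ : T2Space X)
      (_ : MulAction G X) (_ : ContinuousConstSMul G X), IsHamanaBoundary G X) ∧
    -- it is unique up to `G`-equivariant homeomorphism
    (∀ (X Y : Type u) [TopologicalSpace X] [CompactSpace X] [T2Space X] [MulAction G X]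
      [ContinuousConstSMul G X] [TopologicalSpace Y] [CompactSpace Y] [T2Space Y] [MulAction G Y]
      [ContinuousConstSMul G Y], IsHamanaBoundary G X → IsHamanaBoundary G Y →
      ∃ h : X ≃ₜ Y, ∀ (s : G) (x : X), h (s • x) = s • h x) ∧
    -- the image of a unital positive equivariant projection on `ℓ^∞(G)` can be minimal
    (∃ ψ : EllInfty G →ₗ[ℂ] EllInfty G, EllInfty.IsMinimalGProjection ψ) ∧
    ∀ (X : Type u) [TopologicalSpace X] [CompactSpace X] [T2Space X] [MulAction G X]
      [ContinuousConstSMul G X],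
      -- the Hamana boundary is the spectrum of a minimal image ...
      (IsHamanaBoundary G X ↔
        ∃ ψ : EllInfty G →ₗ[ℂ] EllInfty G, EllInfty.IsMinimalGProjection ψ ∧
          ∃ j : C(X, ℂ) →ₗ[ℂ] EllInfty G, EllInfty.IsImageIso ψ j) ∧
      -- ... and is the same thing as the Furstenberg boundary
      (IsHamanaBoundary G X ↔ IsFurstenbergBoundary G X) ∧
      (IsHamanaBoundary G X →
        -- every `G`-injective envelope of `ℂ` is `C(X)`
        (∀ (U : GOperatorSystem.{u, u} G)
          (κ : (GOperatorSystem.complex G).carrier →ₗ[ℂ] U.carrier),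
          GOperatorSystem.IsGInjectiveEnvelope κ →
          ∃ φ : U.carrier ≃ₗ[ℂ] (GOperatorSystem.continuousFunctions G X).carrier,
            GOperatorSystem.IsGExtension φ.toLinearMap) ∧
        -- every minimal image is `C(X)`
        (∀ ψ : EllInfty G →ₗ[ℂ] EllInfty G, EllInfty.IsMinimalGProjection ψ →
          ∃ j : C(X, ℂ) →ₗ[ℂ] EllInfty G, EllInfty.IsImageIso ψ j) ∧
        -- some minimal image is a C*-subalgebra of `ℓ^∞(G)`
        (∃ (ψ : EllInfty G →ₗ[ℂ] EllInfty G) (j : C(X, ℂ) →⋆ₐ[ℂ] EllInfty G),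
          EllInfty.IsMinimalGProjection ψ ∧ EllInfty.IsImageIso ψ j.toLinearMap) ∧
        -- it is a `G`-boundary
        Nonempty X ∧ MulAction.IsMinimal G X ∧ IsStronglyProximal G X ∧
        -- it maps onto every `G`-boundary
        (∀ (B : Type v) [TopologicalSpace B] [MulAction G B] [ContinuousConstSMul G B],
          IsGBoundary G B → IsGImage G X B) ∧
        -- it is trivial exactly when `G` is amenable
        (Subsingleton X ↔ IsAmenable G)) := by
  obtain ⟨X₀, _, _, _, _, _, hX₀⟩ := IsRigidRetract.exists_space G
  obtain ⟨ψ₀, -, hψ₀, -⟩ := hX₀.exists_isImageIso_starAlgHom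
  refine ⟨⟨X₀, _, _, inferInstance, _, _, hX₀.isHamanaBoundary⟩, ?_, ⟨ψ₀, hψ₀⟩, ?_⟩
  · intro X Y _ _ _ _ _ _ _ _ _ _ hX hY
    exact hX.isRigidRetract.exists_homeomorph hY.isRigidRetract
  intro X _ _ _ _ _
  rw [isHamanaBoundary_iff_isRigidRetract]
  refine ⟨⟨fun hX => ⟨ψ₀, hψ₀, hX.exists_isImageIso hψ₀⟩,
      fun ⟨ψ, hψ, j, hj⟩ => hj.isRigidRetract hψ hX₀⟩,
    isFurstenbergBoundary_iff_isRigidRetract.symm, fun hX => ⟨fun U κ hκ => ?_,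
      fun ψ hψ => hX.exists_isImageIso hψ, hX.exists_isImageIso_starAlgHom, hX.nonempty,
      hX.isMinimal, isStronglyProximal_iff.2 hX.isStateProximal, fun B _ _ _ hB => ?_,
      hX.subsingleton_iff⟩⟩
  · obtain ⟨φ, hφ, -⟩ := hX.exists_equiv hκ
    exact ⟨φ, hφ⟩
  · have := hB.compact
    have := hB.hausdorff
    exact hX.isGImage hB
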